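/- Let $n\ge 2$ and write $S^{n-1}$ for the unit sphere of $\mathbb{R}^n$ and $du$ for integration with respect to $(n-1)$-dimensional Hausdorff measure on it. For a compact convex set $K\subset\mathbb{R}^n$ with the origin $o$ in its interior and $u\in S^{n-1}$, let $h_K(u)=\max\{\langle u,x\rangle:x\in K\}$ and $\rho_K(u)=\max\{r\ge 0: ru\in K\}$. For a Borel set $E\subset S^{n-1}$ let $\boldsymbol{\alpha}_K^*(E)$ be the set of $u\in S^{n-1}$ such that some $v\in E$ is an outer unit normal of $K$ at the boundary point $\rho_K(u)u$, and let $\alpha_K(u)$ be the outer unit normal of $K$ at $\rho_K(u)u$, which is unique for almost every $u$. Given $G:[0,\infty)\times S^{n-1}\to[0,\infty)$ with $G_t=\partial G/\partial t$ and $\psi:(0,\infty)\to(0,\infty)$, put $$\widetilde{C}_{G,\psi}(K,E)=\frac1n\int_{\boldsymbol{\alpha}_K^*(E)}\frac{\rho_K(u)\,G_t(\rho_K(u),u)}{\psi(h_K(\alpha_K(u)))}\,du,$$ and $\widetilde{C}_{G}=\widetilde{C}_{G,\psi}$ when $\psi\equiv 1$. For a nonzero finite Borel measure $\mu$ on $S^{n-1}$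 and a continuous strictly increasing $\varphi:[0,\infty)\to[0,\infty)$ with $\varphi(0)=0$ and $\varphi(t)\to\infty$ as $t\to\infty$, put $$\|h_K\|_{\varphi,\mu}=\inf\Big\{\lambda>0:\frac{1}{\varphi(1)\,\mu(S^{n-1})}\int_{S^{n-1}}\varphi\Big(\frac{h_K(u)}{\lambda}\Big)\,d\mu(u)\le 1\Big\}.$$ **Theorem.** Let $\mu=\sum_{i=1}^m\lambda_i\delta_{u_i}$, where $\lambda_i>0$ for $i=1,\dots,m$ and $\{u_1,\dots,u_m\}\subset S^{n-1}$ is not contained in a closed hemisphere. Let $G:[0,\infty)\times S^{n-1}\to[0,\infty)$ be continuous and such that $G_t$ exists and is continuous and positive on $(0,\infty)\times S^{n-1}$. Suppose that $\psi:(0,\infty)\to(0,\infty)$ is continuous, $\lim_{t\to0+}\psi(t)/t=0$, and $\int_1^\infty \frac{\psi(s)}{s}\,ds=\infty$. Let $\varphi(t)=\int_0^t\frac{\psi(s)}{s}\,ds$ for $t\ge 0$. Then there exist a convex polytope $P$ (the convex hull of a finite set) with $o$ in its interior and $\tau>0$ such that $$\mu=\tau\,\widetilde{C}_{G,\psi}(P,\cdot)\qquad\text{and}\qquad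 \|h_P\|_{\varphi,\mu}=1,$$ where $$\tau=\frac{\mu(S^{n-1})}{\widetilde{C}_{G,\psi}(P,S^{n-1})}=\frac{1}{\widetilde{C}_{G}(P,S^{n-1})}\int_{S^{n-1}}\psi(h_P(u))\,d\mu(u).$$ -/

import Mathlib

open MeasureTheory Set Filter Topology

noncomputable section

namespace DualOrlicz

/-- Euclidean space `ℝⁿ`. -/
abbrev Eu (n : ℕ) : Type := EuclideanSpace ℝ (Fin n)

/-- The unit sphere `S^{n-1}` of `ℝⁿ`. -/
abbrev Sph (n : ℕ) : Type := Metric.sphere (0 : Eu n) 1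

/-- The spherical Lebesgue measure on `S^{n-1}`, i.e. `(n-1)`-dimensional Hausdorff measure
in its Euclidean normalization (total mass `n κ_n`, with `κ_n` the volume of the unit ball). -/
def sphMeasure (n : ℕ) : Measure (Sph n) := (volume : Measure (Eu n)).toSphere

/-- The closed hemisphere of `S^{n-1}` centred at `v`. -/
def closedHemisphere {n : ℕ} (v : Sph n) : Set (Sph n) :=
  {u | 0 ≤ inner ℝ (u : Eu n) (v : Eu n)}

/-- The discrete measure `∑ i, lam i • δ_{u i}` on the sphere. -/
def discreteMeasure {n m : ℕ} (lam : Fin m → ℝ) (u : Fin m → Sph n) : Measure (Sph n) :=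
  ∑ i, ENNReal.ofReal (lam i) • Measure.dirac (u i)

/-- A convex polytope is the convex hull of a finite set. -/
def IsConvexPolytope {n : ℕ} (P : Set (Eu n)) : Prop :=
  ∃ s : Set (Eu n), s.Finite ∧ P = convexHull ℝ s

/-- Convex bodies containing the origin in their interior. -/
structure IsBodyAroundOrigin {n : ℕ} (K : Set (Eu n)) : Prop where
  convex : Convex ℝ K
  isCompact : IsCompact K
  zero_mem_interior : (0 : Eu n) ∈ interior K

/-- The support function `h_K(u) = max {⟪u, x⟫ : x ∈ K}`. -/
def supportFn {n : ℕ} (K : Set (Eu n)) (u : Sph n) : ℝ :=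
  sSup ((fun x : Eu n => inner ℝ (u : Eu n) x) '' K)

/-- The radial function `ρ_K(u) = max {r ≥ 0 : r u ∈ K}`. -/
def radialFn {n : ℕ} (K : Set (Eu n)) (u : Sph n) : ℝ :=
  sSup {r : ℝ | 0 ≤ r ∧ r • (u : Eu n) ∈ K}

/-- The radial map `r_K(u) = ρ_K(u) u`. -/
def radialMap {n : ℕ} (K : Set (Eu n)) (u : Sph n) : Eu n :=
  radialFn K u • (u : Eu n)

/-- The normal cone `N(K, z)`. -/
def normalCone {n : ℕ} (K : Set (Eu n)) (z : Eu n) : Set (Eu n) :=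
  {y | ∀ x ∈ K, inner ℝ y (x - z) ≤ 0}

/-- The spherical image of `A ⊆ ∂K`: all unit outer normals of `K` at points of `A`. -/
def sphericalImage {n : ℕ} (K : Set (Eu n)) (A : Set (Eu n)) : Set (Sph n) :=
  {v | ∃ x ∈ A, (v : Eu n) ∈ normalCone K x}

/-- The radial spherical image of `E ⊆ S^{n-1}`. -/
def radialSphericalImage {n : ℕ} (K : Set (Eu n)) (E : Set (Sph n)) : Set (Sph n) :=
  sphericalImage K (radialMap K '' E)

open Classical in
/-- The radial Gauss map `α_K(u)`: the unique element of the radial spherical image of `{u}`.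
Where there is no unique element (a null set of directions `u` for a convex body `K` with
the origin in its interior) the value is arbitrary. -/
def radialGauss {n : ℕ} (K : Set (Eu n)) (u : Sph n) : Sph n :=
  if h : ∃! v, v ∈ radialSphericalImage K {u} then h.choose else u

/-- The reverse spherical image of `E ⊆ S^{n-1}`. -/
def reverseSphericalImage {n : ℕ} (K : Set (Eu n)) (E : Set (Sph n)) : Set (Eu n) :=
  {x | x ∈ frontier K ∧ ∃ v ∈ E, (v : Eu n) ∈ normalCone K x}

/-- The reverse radial spherical image `α*_K(E)` of `E ⊆ S^{n-1}`. -/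
def reverseRadialSphericalImage {n : ℕ} (K : Set (Eu n)) (E : Set (Sph n)) : Set (Sph n) :=
  radialMap K ⁻¹' reverseSphericalImage K E

/-- The partial derivative `G_t(t, u)`. -/
def partialT {n : ℕ} (G : ℝ → Sph n → ℝ) (t : ℝ) (u : Sph n) : ℝ :=
  deriv (fun s => G s u) t

/-- The general dual Orlicz curvature measure of a convex body `K` with the origin in its
interior, as a real-valued set function. -/
def dualOrliczCurvature {n : ℕ} (G : ℝ → Sph n → ℝ) (ψ : ℝ → ℝ) (K : Set (Eu n))
    (E : Set (Sph n)) : ℝ :=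
  (1 / (n : ℝ)) * ∫ u in reverseRadialSphericalImage K E,
    radialFn K u * partialT G (radialFn K u) u / ψ (supportFn K (radialGauss K u)) ∂(sphMeasure n)

/-- The function `φ(t) = ∫₀ᵗ ψ(s)/s ds`. -/
def orliczPhi (ψ : ℝ → ℝ) (t : ℝ) : ℝ := ∫ s in (0 : ℝ)..t, ψ s / s

/-- The Orlicz (Luxemburg) functional `‖h‖_{φ,μ}`. -/
def orliczNorm {n : ℕ} (φ : ℝ → ℝ) (μ : Measure (Sph n)) (h : Sph n → ℝ) : ℝ :=
  sInf {l : ℝ | 0 < l ∧ 1 / (φ 1 * μ.real univ) * ∫ u, φ (h u / l) ∂μ ≤ 1}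

end DualOrlicz

end

open DualOrlicz

/-!
The polytope is found by maximizing a dual volume over support numbers. Let `vᵢ` be the distinct
atoms of `μ` and `λᵢ` their masses. For `h ≥ 0` let `wulff v h = {x | ⟪vᵢ, x⟫ ≤ hᵢ}`, with radial
function `ρ_h(w) = min hᵢ / ⟪vᵢ, w⟫` (`radius`), the minimum being over the `i` with `⟪vᵢ, w⟫ > 0`.
This is continuous in `h` for each `w`, so the dual volume `V(h) = ∫ G(ρ_h(w), w) dw` is continuous
and attains its maximum on the compact set `h ≥ 0`, `∑ λᵢ φ(hᵢ) ≤ φ(1) μ(S)` (`orliczBall`).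

A maximizer has `hᵢ > 0` for all `i` (`pos_of_isMaxOn_dualVolume`). Since `φ'(0) = 0`, raising the
vanishing `hᵢ` to `ε` costs only `o(ε)` in the constraint, which an arbitrarily small multiple of `ε`
taken off the other support numbers compensates, whereas the dual volume gains at least `c ε`: the
directions in a layer of measure `≥ c ε` around the polar cone of the corresponding `vᵢ` change from
`ρ = 0` to values bounded below (`exists_le_sphMeasure_layer`).

At a maximizer with positive support numbers `V` is differentiable, with
`∂V/∂hᵢ = hᵢ⁻¹ ∫ ρ G_t(ρ, ·)` over the directions of the `i`-th facet (`hasFDerivAt_dualVolume`). As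
`φ'(t) = ψ(t)/t`, the Lagrange condition (`exists_multiplier_of_isMaxOn`) says that this integral is
`κ λᵢ ψ(hᵢ)`, so that every facet is nonempty and `hᵢ` is the support function at `vᵢ`. Almost every
direction meets the boundary in the interior of one facet, where the facet normal is the only outer
normal; so the curvature measure is the sum of these integrals divided by `ψ(hᵢ)`
(`dualOrliczCurvature_wulff`), which is `κ/n · μ`. The constraint is active at the maximizer, and this
is the normalization of the Orlicz norm.
-/

namespace DualOrlicz

/-! ### Wulff shapes and their radial functions -/

variable {n : ℕ} {ι : Type*}

/-- The Wulff shape `{x | ⟪vᵢ, x⟫ ≤ hᵢ for all i}`: the intersection of the halfspaces with outer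
unit normals `vᵢ` at signed distances `hᵢ` from the origin. -/
def wulff (v : ι → Sph n) (h : ι → ℝ) : Set (Eu n) :=
  {x | ∀ i, inner ℝ (v i : Eu n) x ≤ h i}

/-- The radial function of the Wulff shape, as an explicit minimum of `hᵢ / ⟪vᵢ, w⟫` over the
halfspaces whose boundary is hit by the ray in direction `w`. It is defined for arbitrary `h`, and
agrees with `radialFn` of `wulff v h` when `h ≥ 0`, see `radialFn_wulff`. -/
noncomputable def radius (v : ι → Sph n) (h : ι → ℝ) (w : Sph n) : ℝ :=
  ⨅ i : {i // 0 < inner ℝ (v i : Eu n) (w : Eu n)}, h i / inner ℝ (v i : Eu n) (w : Eu n)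

/-- Every open hemisphere contains one of the `vᵢ`: they are not contained in a closed
hemisphere. -/
def MeetsOpenHemispheres (v : ι → Sph n) : Prop :=
  ∀ w : Sph n, ∃ i, 0 < inner ℝ (v i : Eu n) (w : Eu n)

variable {v : ι → Sph n} {h : ι → ℝ} {w : Sph n}

lemma norm_sphere (w : Sph n) : ‖(w : Eu n)‖ = 1 := by simp

lemma inner_sphere_self (w : Sph n) : inner ℝ (w : Eu n) (w : Eu n) = 1 := by
  rw [real_inner_self_eq_norm_sq, norm_sphere, one_pow]

lemma inner_sphere_le (w : Sph n) (x : Eu n) : inner ℝ (w : Eu n) x ≤ ‖x‖ := by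
  simpa using real_inner_le_norm (w : Eu n) x

lemma abs_inner_sphere_le (w : Sph n) (x : Eu n) : |inner ℝ (w : Eu n) x| ≤ ‖x‖ := by
  simpa using abs_real_inner_le_norm (w : Eu n) x

section radius

variable [Finite ι]

lemma radius_attained (hv : MeetsOpenHemispheres v) (h : ι → ℝ) (w : Sph n) :
    ∃ i, 0 < inner ℝ (v i : Eu n) (w : Eu n) ∧
      radius v h w * inner ℝ (v i : Eu n) (w : Eu n) = h i := by
  have : Nonempty {i // 0 < inner ℝ (v i : Eu n) (w : Eu n)} :=
    let ⟨i, hi⟩ := hv w; ⟨⟨i, hi⟩⟩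
  obtain ⟨i, hi⟩ := exists_eq_ciInf_of_finite
    (f := fun i : {i // 0 < inner ℝ (v i : Eu n) (w : Eu n)} =>
      h i / inner ℝ (v i : Eu n) (w : Eu n))
  refine ⟨i, i.2, ?_⟩
  rw [radius, ← hi]
  exact div_mul_cancel₀ _ i.2.ne'

lemma radius_mul_le {i : ι} (hi : 0 < inner ℝ (v i : Eu n) (w : Eu n)) :
    radius v h w * inner ℝ (v i : Eu n) (w : Eu n) ≤ h i := by
  rw [← le_div_iff₀ hi]
  exact ciInf_le (Set.finite_range _).bddBelow
    (⟨i, hi⟩ : {i // 0 < inner ℝ (v i : Eu n) (w : Eu n)})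

lemma lt_radius_iff (hv : MeetsOpenHemispheres v) {a : ℝ} :
    a < radius v h w ↔ ∀ i, 0 < inner ℝ (v i : Eu n) (w : Eu n) →
      a * inner ℝ (v i : Eu n) (w : Eu n) < h i := by
  constructor
  · intro ha i hi
    exact (mul_lt_mul_of_pos_right ha hi).trans_le (radius_mul_le hi)
  · intro ha
    obtain ⟨i, hi, e⟩ := radius_attained hv h w
    exact lt_of_mul_lt_mul_right (e ▸ ha i hi) hi.le

lemma radius_lt_iff (hv : MeetsOpenHemispheres v) {a : ℝ} :
    radius v h w < a ↔ ∃ i, 0 < inner ℝ (v i : Eu n) (w : Eu n) ∧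
      h i < a * inner ℝ (v i : Eu n) (w : Eu n) := by
  constructor
  · intro ha
    obtain ⟨i, hi, e⟩ := radius_attained hv h w
    exact ⟨i, hi, e ▸ mul_lt_mul_of_pos_right ha hi⟩
  · rintro ⟨i, hi, e⟩
    exact lt_of_mul_lt_mul_right ((radius_mul_le hi).trans_lt e) hi.le

lemma le_radius_iff (hv : MeetsOpenHemispheres v) {a : ℝ} :
    a ≤ radius v h w ↔ ∀ i, 0 < inner ℝ (v i : Eu n) (w : Eu n) →
      a * inner ℝ (v i : Eu n) (w : Eu n) ≤ h i := by
  rw [← not_lt, radius_lt_iff hv]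
  push Not
  rfl

lemma radius_nonneg (hv : MeetsOpenHemispheres v) (hh : ∀ i, 0 ≤ h i) : 0 ≤ radius v h w :=
  (le_radius_iff hv).2 fun i _ => by simpa using hh i

lemma radius_pos (hv : MeetsOpenHemispheres v) (hh : ∀ i, 0 < h i) : 0 < radius v h w :=
  (lt_radius_iff hv).2 fun i _ => by simpa using hh i

lemma radius_eq_zero (hv : MeetsOpenHemispheres v) (hh : ∀ i, 0 ≤ h i) {i : ι} (hi : h i = 0)
    (hiw : 0 < inner ℝ (v i : Eu n) (w : Eu n)) : radius v h w = 0 :=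
  le_antisymm (le_of_mul_le_mul_right (by simpa [hi] using radius_mul_le (h := h) hiw) hiw)
    (radius_nonneg hv hh)

/-- Unlike `radius_mul_le`, this includes the halfspaces which the ray in direction `w` never
leaves. -/
lemma radius_mul_le' (hv : MeetsOpenHemispheres v) (hh : ∀ i, 0 ≤ h i) (i : ι) :
    radius v h w * inner ℝ (v i : Eu n) (w : Eu n) ≤ h i := by
  rcases lt_or_ge 0 (inner ℝ (v i : Eu n) (w : Eu n)) with hi | hi
  · exact radius_mul_le hi
  · exact (mul_nonpos_of_nonneg_of_nonpos (radius_nonneg hv hh) hi).trans (hh i)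

lemma continuous_radius_left (hv : MeetsOpenHemispheres v) (w : Sph n) :
    Continuous fun h : ι → ℝ => radius v h w := by
  rw [continuous_iff_lower_upperSemicontinuous, lowerSemicontinuous_iff_isOpen_preimage,
    upperSemicontinuous_iff_isOpen_preimage]
  constructor <;> intro a
  · have : (fun h : ι → ℝ => radius v h w) ⁻¹' Ioi a = ⋂ i, {h |
        0 < inner ℝ (v i : Eu n) (w : Eu n) → a * inner ℝ (v i : Eu n) (w : Eu n) < h i} := by
      ext h
      simp [lt_radius_iff hv]
    rw [this]
    refine isOpen_iInter_of_finite fun i => ?_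
    by_cases hi : 0 < inner ℝ (v i : Eu n) (w : Eu n)
    · simpa only [hi, true_imp_iff] using isOpen_lt continuous_const (continuous_apply i)
    · simp [hi]
  · have : (fun h : ι → ℝ => radius v h w) ⁻¹' Iio a = ⋃ i, {h |
        0 < inner ℝ (v i : Eu n) (w : Eu n) ∧ h i < a * inner ℝ (v i : Eu n) (w : Eu n)} := by
      ext h
      simp [radius_lt_iff hv]
    rw [this]
    exact isOpen_iUnion fun i => isOpen_const.and (isOpen_lt (continuous_apply i) continuous_const)

lemma upperSemicontinuous_radius (hv : MeetsOpenHemispheres v) (h : ι → ℝ) :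
    UpperSemicontinuous (radius v h) := by
  rw [upperSemicontinuous_iff_isOpen_preimage]
  intro a
  have : radius v h ⁻¹' Iio a = ⋃ i, {w : Sph n |
      0 < inner ℝ (v i : Eu n) (w : Eu n) ∧ h i < a * inner ℝ (v i : Eu n) (w : Eu n)} := by
    ext w
    simp [radius_lt_iff hv]
  rw [this]
  exact isOpen_iUnion fun i => (isOpen_lt (by fun_prop) (by fun_prop)).and
    (isOpen_lt (by fun_prop) (by fun_prop))

lemma measurable_radius (hv : MeetsOpenHemispheres v) (h : ι → ℝ) : Measurable (radius v h) :=
  (upperSemicontinuous_radius hv h).measurable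

lemma continuous_radius_right (hv : MeetsOpenHemispheres v) (hh : ∀ i, 0 < h i) :
    Continuous (radius v h) := by
  rw [continuous_iff_lower_upperSemicontinuous]
  refine ⟨?_, upperSemicontinuous_radius hv h⟩
  rw [lowerSemicontinuous_iff_isOpen_preimage]
  intro a
  rcases lt_or_ge a 0 with ha | ha
  · convert isOpen_univ
    exact eq_univ_of_forall fun w => ha.trans (radius_pos hv hh)
  · have : radius v h ⁻¹' Ioi a = ⋂ i, {w : Sph n |
        a * inner ℝ (v i : Eu n) (w : Eu n) < h i} := by
      ext w
      simp only [mem_preimage, mem_Ioi, lt_radius_iff hv, mem_iInter, mem_ofPred_eq]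
      refine forall_congr' fun i => ⟨fun H => ?_, fun H _ => H⟩
      rcases lt_or_ge 0 (inner ℝ (v i : Eu n) (w : Eu n)) with hi | hi
      · exact H hi
      · exact (mul_nonpos_of_nonneg_of_nonpos ha hi).trans_lt (hh i)
    rw [this]
    exact isOpen_iInter_of_finite fun i => isOpen_lt (by fun_prop) (by fun_prop)

/-- By compactness of the sphere, `maxᵢ ⟪vᵢ, w⟫` is bounded below by a positive constant. -/
lemma MeetsOpenHemispheres.exists_uniform (hv : MeetsOpenHemispheres v) :
    ∃ c : ℝ, 0 < c ∧ ∀ w : Sph n, ∃ i, c ≤ inner ℝ (v i : Eu n) (w : Eu n) := by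
  have hc := continuous_radius_right (h := fun _ => 1) hv (fun _ => one_pos)
  obtain ⟨M, hM⟩ := (isCompact_range hc).bddAbove
  refine ⟨(max M 1)⁻¹, by positivity, fun w => ?_⟩
  obtain ⟨i, hi, e⟩ := radius_attained hv (fun _ => (1 : ℝ)) w
  refine ⟨i, ?_⟩
  have h1 : radius v (fun _ => (1 : ℝ)) w ≤ max M 1 := (hM ⟨w, rfl⟩).trans (le_max_left _ _)
  rw [inv_le_iff_one_le_mul₀ (by positivity)]
  linarith [mul_le_mul_of_nonneg_right h1 hi.le]

/-- A bound for the radial function which is linear in the support numbers. -/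
lemma exists_radius_le (hv : MeetsOpenHemispheres v) :
    ∃ C : ℝ, 0 < C ∧ ∀ (h : ι → ℝ) (M : ℝ), 0 ≤ M → (∀ i, h i ≤ M) → ∀ w,
      radius v h w ≤ C * M := by
  obtain ⟨c, hc, H⟩ := hv.exists_uniform
  refine ⟨c⁻¹, by positivity, fun h M hM hhM w => ?_⟩
  obtain ⟨i, hi⟩ := H w
  have h1 := (radius_mul_le (h := h) (hc.trans_le hi)).trans (hhM i)
  by_contra! hlt
  have h2 : 0 ≤ c⁻¹ * M := by positivity
  have : M < radius v h w * inner ℝ (v i : Eu n) (w : Eu n) := by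
    calc M = c⁻¹ * M * c := by field_simp
      _ < radius v h w * c := by gcongr
      _ ≤ _ := by gcongr; exact h2.trans hlt.le
  linarith

lemma radialFn_wulff (hv : MeetsOpenHemispheres v) (hh : ∀ i, 0 ≤ h i) (w : Sph n) :
    radialFn (wulff v h) w = radius v h w := by
  refine IsGreatest.csSup_eq ⟨⟨radius_nonneg hv hh, fun i => ?_⟩, ?_⟩
  · rw [inner_smul_right]
    exact radius_mul_le' hv hh i
  · rintro r ⟨-, hr⟩
    exact (le_radius_iff hv).2 fun i _ => by simpa [inner_smul_right] using hr i

end radius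

/-! ### Wulff shapes as convex polytopes -/

lemma convex_wulff (v : ι → Sph n) (h : ι → ℝ) : Convex ℝ (wulff v h) := by
  rw [wulff, ofPred_forall]
  exact convex_iInter fun i => convex_halfSpace_le (innerₗ (Eu n) (v i : Eu n)).isLinear _

lemma isClosed_wulff (v : ι → Sph n) (h : ι → ℝ) : IsClosed (wulff v h) := by
  rw [wulff, ofPred_forall]
  exact isClosed_iInter fun i => isClosed_le (by fun_prop) (by fun_prop)

variable [Finite ι]

lemma isCompact_wulff (hv : MeetsOpenHemispheres v) (h : ι → ℝ) : IsCompact (wulff v h) := by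
  obtain ⟨c, hc, H⟩ := hv.exists_uniform
  obtain ⟨M, hM⟩ := (Set.finite_range h).bddAbove
  refine (isCompact_closedBall (0 : Eu n) (max (c⁻¹ * M) 0)).of_isClosed_subset
    (isClosed_wulff v h) fun x hx => ?_
  rw [mem_closedBall_zero_iff]
  rcases eq_or_ne x 0 with rfl | hx0
  · simp
  have hpos : 0 < ‖x‖ := norm_pos_iff.2 hx0
  obtain ⟨i, hi⟩ := H ⟨‖x‖⁻¹ • x, by simp [norm_smul, hpos.ne']⟩
  simp only [inner_smul_right] at hi
  have h1 := (hx i).trans (hM ⟨i, rfl⟩)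
  refine le_max_of_le_left ?_
  rw [← div_eq_inv_mul, le_div_iff₀ hc]
  rw [inv_mul_eq_div, le_div_iff₀ hpos] at hi
  linarith

lemma isBodyAroundOrigin_wulff (hv : MeetsOpenHemispheres v) (hh : ∀ i, 0 < h i) :
    IsBodyAroundOrigin (wulff v h) where
  convex := convex_wulff v h
  isCompact := isCompact_wulff hv h
  zero_mem_interior := by
    refine mem_interior.2 ⟨⋂ i, {x | inner ℝ (v i : Eu n) x < h i}, fun x hx i => ?_,
      isOpen_iInter_of_finite fun i => isOpen_lt (by fun_prop) (by fun_prop), ?_⟩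
    · exact (mem_iInter.1 hx i).le
    · simpa using hh

/-- Moving from `x` in a direction `y` that does not leave the halfspaces active at `x` stays
in the Wulff shape for a short time. -/
lemma eventually_add_smul_mem_wulff {x y : Eu n} (hx : x ∈ wulff v h)
    (hy : ∀ i, inner ℝ (v i : Eu n) x = h i → inner ℝ (v i : Eu n) y ≤ 0) :
    ∀ᶠ t : ℝ in 𝓝[>] 0, x + t • y ∈ wulff v h := by
  simp only [wulff, mem_ofPred_eq, eventually_all]
  intro i
  rcases (hx i).lt_or_eq with hi | hi
  · have : Tendsto (fun t : ℝ => inner ℝ (v i : Eu n) (x + t • y)) (𝓝[>] 0)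
        (𝓝 (inner ℝ (v i : Eu n) (x + (0 : ℝ) • y))) :=
      tendsto_nhdsWithin_of_tendsto_nhds (Continuous.tendsto (by fun_prop) 0)
    rw [zero_smul, add_zero] at this
    exact (this.eventually_lt_const hi).mono fun t => le_of_lt
  · filter_upwards [self_mem_nhdsWithin] with t (ht : 0 < t)
    rw [inner_add_right, inner_smul_right, hi]
    nlinarith [hy i hi]

/-- An extreme point of a Wulff shape is determined by the halfspaces active at it; hence there
are finitely many extreme points, and the Krein–Milman theorem applies. -/
lemma isConvexPolytope_wulff (hv : MeetsOpenHemispheres v) (h : ι → ℝ) :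
    IsConvexPolytope (wulff v h) := by
  have hfin : ((wulff v h).extremePoints ℝ).Finite := by
    refine Set.Finite.of_injOn (f := fun x => {i | inner ℝ (v i : Eu n) x = h i}) (t := univ)
      (mapsTo_univ _ _) ?_ Set.finite_univ
    intro x hx y hy hxy
    by_contra hne
    have key : ∀ i, inner ℝ (v i : Eu n) x = h i → inner ℝ (v i : Eu n) (y - x) = 0 := by
      intro i hi
      have : inner ℝ (v i : Eu n) y = h i := (Set.ext_iff.1 hxy i).1 hi
      rw [inner_sub_right, hi, this, sub_self]
    obtain ⟨t, ⟨h1, h2⟩, ht⟩ := ((eventually_add_smul_mem_wulff (y := y - x) hx.1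
      fun i hi => (key i hi).le).and (eventually_add_smul_mem_wulff (y := -(y - x)) hx.1
      fun i hi => by rw [inner_neg_right, key i hi, neg_zero])).and self_mem_nhdsWithin |>.exists
    have h3 := hx.2 h1 h2 ⟨1 / 2, 1 / 2, by norm_num, by norm_num, by norm_num, by module⟩
    have : t • (y - x) = 0 := by simpa using h3
    rcases smul_eq_zero.1 this with h0 | h0
    · exact (ne_of_gt ht) h0
    · exact hne (sub_eq_zero.1 h0).symm
  refine ⟨_, hfin, ?_⟩
  rw [← (hfin.isCompact_convexHull ℝ).isClosed.closure_eq,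
    closure_convexHull_extremePoints (isCompact_wulff hv h) (convex_wulff v h)]

/-- At a boundary point of a Wulff shape lying on a single facet hyperplane, the outer unit
normal is the normal of that facet. -/
lemma mem_normalCone_wulff_iff {x : Eu n} (hx : x ∈ wulff v h) {k : ι}
    (hk : ∀ i, inner ℝ (v i : Eu n) x = h i ↔ i = k) (e : Sph n) :
    (e : Eu n) ∈ normalCone (wulff v h) x ↔ e = v k := by
  constructor
  · intro he
    -- test the normal against the directions `-v k` and `e - ⟪e, v k⟫ v k`
    have key : ∀ y : Eu n, inner ℝ (v k : Eu n) y ≤ 0 → inner ℝ (e : Eu n) y ≤ 0 := by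
      intro y hy
      obtain ⟨t, h1, ht⟩ := ((eventually_add_smul_mem_wulff (y := y) hx fun i hi => by
        rw [(hk i).1 hi]; exact hy).and self_mem_nhdsWithin).exists
      have := he _ h1
      rw [add_sub_cancel_left, inner_smul_right] at this
      exact nonpos_of_mul_nonpos_right this ht
    set c := inner ℝ (e : Eu n) (v k : Eu n) with hc
    have h1 : 0 ≤ c := by
      have := key (-(v k : Eu n)) (by rw [inner_neg_right, inner_sphere_self]; norm_num)
      rw [inner_neg_right] at this
      linarith
    have h2 : 1 - c * c ≤ 0 := by
      have := key ((e : Eu n) - c • (v k : Eu n)) (by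
        rw [inner_sub_right, inner_smul_right, inner_sphere_self, real_inner_comm, ← hc]; simp)
      rwa [inner_sub_right, inner_smul_right, inner_sphere_self, ← hc] at this
    have h3 : c ≤ 1 := by simpa using inner_sphere_le e (v k : Eu n)
    have h4 : c = 1 := by nlinarith
    exact Subtype.ext ((inner_eq_one_iff_of_norm_eq_one (norm_sphere e) (norm_sphere (v k))).1 h4)
  · rintro rfl y hy
    rw [inner_sub_right, (hk k).2 rfl]
    linarith [hy k]

end DualOrlicz

open scoped Pointwise

namespace DualOrlicz

/-! ### The spherical measure -/

section sphere

variable {n : ℕ} {ι : Type*} {v : ι → Sph n}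

instance : IsFiniteMeasure (sphMeasure n) := by unfold sphMeasure; infer_instance

instance : (sphMeasure n).IsOpenPosMeasure := by unfold sphMeasure; infer_instance

lemma sphMeasure_inner_eq_zero {y : Eu n} (hy : y ≠ 0) :
    sphMeasure n {w | inner ℝ y (w : Eu n) = 0} = 0 := by
  have hm : MeasurableSet {w : Sph n | inner ℝ y (w : Eu n) = 0} :=
    (isClosed_eq (by fun_prop) (by fun_prop)).measurableSet
  rw [sphMeasure, Measure.toSphere_apply' _ hm]
  refine mul_eq_zero_of_right _ (measure_mono_null (t := ((ℝ ∙ y)ᗮ : Submodule ℝ (Eu n))) ?_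
    (Measure.addHaar_submodule _ _ fun htop => ?_))
  · rintro _ ⟨r, -, _, ⟨w, hw, rfl⟩, rfl⟩
    rw [SetLike.mem_coe, Submodule.mem_orthogonal_singleton_iff_inner_right]
    simp only [inner_smul_right]
    rw [show inner ℝ y (w : Eu n) = 0 from hw, mul_zero]
  · have : y ∈ (ℝ ∙ y)ᗮ := htop ▸ Submodule.mem_top
    rw [Submodule.mem_orthogonal_singleton_iff_inner_right, inner_self_eq_zero] at this
    exact hy this

lemma exists_sphere_inner_eq_zero (hn : 2 ≤ n) (u : Sph n) :
    ∃ w : Sph n, inner ℝ (u : Eu n) (w : Eu n) = 0 := by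
  have hd : (ℝ ∙ (u : Eu n))ᗮ ≠ ⊥ := by
    intro h0
    rw [Submodule.orthogonal_eq_bot_iff] at h0
    have h1 := finrank_span_singleton (K := ℝ) (v := (u : Eu n)) (by
      intro h; simpa [h] using norm_sphere u)
    rw [h0, finrank_top, finrank_euclideanSpace_fin] at h1
    omega
  obtain ⟨y, hy, hy0⟩ := Submodule.exists_mem_ne_zero_of_ne_bot hd
  rw [Submodule.mem_orthogonal_singleton_iff_inner_right] at hy
  refine ⟨⟨‖y‖⁻¹ • y, by simp [norm_smul, norm_ne_zero_iff.2 hy0]⟩, ?_⟩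
  simp only [inner_smul_right, hy, mul_zero]

/-- The directions `w` that violate some constraint `⟪vᵢ, w⟫ ≤ 0`, `i ∈ I`, but none by more than
`η`: the layer of width `η` around the spherical trace of a polyhedral cone. -/
def layer (v : ι → Sph n) (I : Set ι) (η : ℝ) : Set (Sph n) :=
  {w | (∃ i ∈ I, 0 < inner ℝ (v i : Eu n) (w : Eu n)) ∧
    ∀ i ∈ I, inner ℝ (v i : Eu n) (w : Eu n) ≤ η}

lemma measurableSet_layer [Finite ι] (v : ι → Sph n) (I : Set ι) (η : ℝ) :
    MeasurableSet (layer v I η) := by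
  have e : layer v I η = (⋃ i ∈ I, {w : Sph n | 0 < inner ℝ (v i : Eu n) (w : Eu n)}) ∩
      ⋂ i ∈ I, {w : Sph n | inner ℝ (v i : Eu n) (w : Eu n) ≤ η} := by
    ext w; simp [layer]
  rw [e]
  refine MeasurableSet.inter ?_ ?_
  · exact (isOpen_biUnion fun i _ => isOpen_lt (by fun_prop) (by fun_prop)).measurableSet
  · exact (isClosed_biInter fun i _ => isClosed_le (by fun_prop) (by fun_prop)).measurableSet

/-- A set of nonzero vectors in a ball whose directions lie in `A` bounds the spherical measure of
`A` from below. -/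
lemma volume_le_sphMeasure {A : Set (Sph n)} (hA : MeasurableSet A) {T : Set (Eu n)} {R : ℝ}
    (hR : 0 < R) (hT : ∀ x ∈ T, 0 < ‖x‖ ∧ ‖x‖ < R ∧ ∃ w ∈ A, x = ‖x‖ • (w : Eu n)) (hn : n ≠ 0) :
    (volume : Measure (Eu n)).real T ≤ R ^ n * (sphMeasure n).real A := by
  have hsub : T ⊆ R • (Ioo (0 : ℝ) 1 • ((↑) '' A : Set (Eu n))) := by
    intro x hx
    obtain ⟨h0, h1, w, hw, e⟩ := hT x hx
    refine ⟨(‖x‖ / R) • (w : Eu n), ⟨‖x‖ / R, ⟨by positivity, (div_lt_one hR).2 h1⟩, w,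
      ⟨w, hw, rfl⟩, rfl⟩, ?_⟩
    simp only [smul_smul, mul_div_cancel₀ _ hR.ne']
    exact e.symm
  have hfin : volume (Ioo (0 : ℝ) 1 • ((↑) '' A : Set (Eu n))) ≠ ⊤ := by
    refine ((measure_mono ?_).trans_lt (measure_ball_lt_top (x := (0 : Eu n)) (r := 1))).ne
    rintro _ ⟨r, hr, _, ⟨w, -, rfl⟩, rfl⟩
    simp only [mem_ball_zero_iff, norm_smul, norm_sphere, mul_one, Real.norm_eq_abs,
      abs_of_pos hr.1, hr.2]
  have hfin' : volume (R • (Ioo (0 : ℝ) 1 • ((↑) '' A : Set (Eu n)))) ≠ ⊤ := by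
    rw [Measure.addHaar_smul]
    exact ENNReal.mul_ne_top ENNReal.ofReal_ne_top hfin
  refine (measureReal_mono hsub hfin').trans ?_
  have e1 : (sphMeasure n).real A = n * (volume : Measure (Eu n)).real
      (Ioo (0 : ℝ) 1 • ((↑) '' A : Set (Eu n))) := by
    simp [measureReal_def, sphMeasure, Measure.toSphere_apply' _ hA]
  have e2 : (volume : Measure (Eu n)).real (R • (Ioo (0 : ℝ) 1 • ((↑) '' A : Set (Eu n)))) =
      R ^ n * (volume : Measure (Eu n)).real (Ioo (0 : ℝ) 1 • ((↑) '' A : Set (Eu n))) := by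
    rw [measureReal_def, Measure.addHaar_smul, ENNReal.toReal_mul, measureReal_def]
    simp [abs_of_pos hR, pow_nonneg hR.le]
  rw [e1, e2]
  gcongr
  refine le_mul_of_one_le_left measureReal_nonneg ?_
  exact_mod_cast Nat.one_le_iff_ne_zero.2 hn

/-- If the cone `{x | ⟪vᵢ, x⟫ ≤ 0 for all i ∈ I}` has an interior direction `u₀`, then the
spherical layer of width `η` around it has measure of order at least `η`.

With `f x = max_{i ∈ I} ⟪vᵢ, x⟫`, walking from a point with `f > 0` in steps `η u₀` makes `f` fall by
at least `a η` and at most `η` in each step, so that after `O(1/η)` steps the Euclidean layer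
`0 < f ≤ η` is met. Hence `O(1/η)` translates of a bounded part of that layer cover a fixed ball. The
ball is chosen away from the line `ℝ u₀`, so that the walks avoid a neighbourhood of the origin. -/
lemma exists_le_sphMeasure_layer [Finite ι] (hn : 2 ≤ n) {I : Set ι} (hI : I.Nonempty)
    {u₀ : Sph n} (hu₀ : ∀ i ∈ I, inner ℝ (v i : Eu n) (u₀ : Eu n) < 0) :
    ∃ c : ℝ, 0 < c ∧ ∀ η : ℝ, 0 < η → η ≤ 1 → c * η ≤ (sphMeasure n).real (layer v I η) := by
  obtain ⟨a, ha, hau⟩ : ∃ a : ℝ, 0 < a ∧ ∀ i ∈ I, inner ℝ (v i : Eu n) (u₀ : Eu n) ≤ -a := by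
    obtain ⟨j, hj, hmax⟩ := Set.exists_max_image I
      (fun i => inner ℝ (v i : Eu n) (u₀ : Eu n)) I.toFinite hI
    exact ⟨-inner ℝ (v j : Eu n) (u₀ : Eu n), neg_pos.2 (hu₀ j hj), fun i hi => by
      simpa using hmax i hi⟩
  obtain ⟨w₀, hw₀⟩ := exists_sphere_inner_eq_zero hn u₀
  have hw₀' : inner ℝ (w₀ : Eu n) (u₀ : Eu n) = 0 := by rw [real_inner_comm, hw₀]
  obtain ⟨j, hj⟩ := hI
  set y : Eu n := (w₀ : Eu n) - (2 / a) • (u₀ : Eu n) with hy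
  set F : ℝ := ‖y‖ + 1 / 2 with hF
  set R : ℝ := F + (F / a + 1) + 1 with hR
  have hF0 : 0 < F := by positivity
  have hR0 : 0 < R := by positivity
  set B : ℝ := (volume : Measure (Eu n)).real (Metric.ball y (1 / 2)) with hB
  have hB0 : 0 < B := ENNReal.toReal_pos (Metric.measure_ball_pos _ _ (by norm_num)).ne'
    measure_ball_lt_top.ne
  refine ⟨B / (2 * (2 * F / a + 2) * R ^ n), by positivity, fun η hη hη1 => ?_⟩
  -- the Euclidean layer has width `δ`, which becomes `2 δ` on vectors of norm at least `1 / 2`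
  set δ : ℝ := η / 2 with hδ
  have hδ0 : 0 < δ := by positivity
  set N : ℕ := ⌈F / (a * δ)⌉₊ with hN
  have hN1 : F ≤ N * (a * δ) := (div_le_iff₀ (by positivity)).1 (Nat.le_ceil _)
  have hN2 : (N : ℝ) * δ ≤ F / a + 1 := by
    have : (N : ℝ) ≤ F / (a * δ) + 1 := (Nat.ceil_lt_add_one (by positivity)).le
    calc (N : ℝ) * δ ≤ (F / (a * δ) + 1) * δ := by gcongr
      _ = F / a + δ := by field_simp
      _ ≤ F / a + 1 := by gcongr; linarith
  set T : Set (Eu n) := {x | ((∃ i ∈ I, 0 < inner ℝ (v i : Eu n) x) ∧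
    ∀ i ∈ I, inner ℝ (v i : Eu n) x ≤ δ) ∧ 1 / 2 ≤ ‖x‖ ∧ ‖x‖ < R} with hT
  have hTsph : (volume : Measure (Eu n)).real T ≤ R ^ n * (sphMeasure n).real (layer v I η) := by
    refine volume_le_sphMeasure (measurableSet_layer v I η) hR0 ?_ (by omega)
    rintro x ⟨⟨⟨i, hi, hix⟩, hx⟩, hx1, hx2⟩
    have hx0 : 0 < ‖x‖ := by linarith
    refine ⟨hx0, hx2, ⟨‖x‖⁻¹ • x, by simp [norm_smul, hx0.ne']⟩, ⟨⟨i, hi, ?_⟩, ?_⟩, ?_⟩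
    · simp only [inner_smul_right]; positivity
    · intro k hk
      simp only [inner_smul_right]
      rw [inv_mul_le_iff₀ hx0]
      have := hx k hk
      nlinarith
    · simp [smul_smul, hx0.ne']
  have hcover : Metric.ball y (1 / 2) ⊆
      ⋃ k ∈ Finset.range (N + 1), (fun x : Eu n => x + (k * δ) • (u₀ : Eu n)) ⁻¹' T := by
    intro x hx
    rw [Metric.mem_ball, dist_eq_norm] at hx
    have hxF : ‖x‖ ≤ F := by linarith [norm_le_norm_add_norm_sub' x y]
    have hin : ∀ (k : ℕ) (i : ι), inner ℝ (v i : Eu n) (x + (k * δ) • (u₀ : Eu n)) =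
        inner ℝ (v i : Eu n) x + k * δ * inner ℝ (v i : Eu n) (u₀ : Eu n) := fun k i => by
      rw [inner_add_right, inner_smul_right]
    have hNx : ∀ i ∈ I, inner ℝ (v i : Eu n) (x + (N * δ) • (u₀ : Eu n)) ≤ δ := by
      intro i hi
      rw [hin]
      have h1 := inner_sphere_le (v i) x
      have h2 : N * δ * inner ℝ (v i : Eu n) (u₀ : Eu n) ≤ N * δ * (-a) := by
        gcongr; exact hau i hi
      nlinarith
    classical
    have hex : ∃ k : ℕ, ∀ i ∈ I, inner ℝ (v i : Eu n) (x + (k * δ) • (u₀ : Eu n)) ≤ δ :=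
      ⟨N, hNx⟩
    -- the first step after which `f ≤ δ`
    set k := Nat.find hex with hk
    have hkN : k ≤ N := Nat.find_min' hex hNx
    simp only [mem_iUnion, Finset.mem_range, mem_preimage]
    refine ⟨k, by omega, ⟨?_, Nat.find_spec hex⟩, ?_, ?_⟩
    · rcases Nat.eq_zero_or_pos k with h0 | h0
      · refine ⟨j, hj, ?_⟩
        have h1 : inner ℝ (v j : Eu n) y - 1 / 2 < inner ℝ (v j : Eu n) x := by
          have := (abs_inner_sphere_le (v j) (x - y)).trans_lt hx
          rw [inner_sub_right] at this
          linarith [(abs_lt.1 this).1]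
        have h2 : 1 ≤ inner ℝ (v j : Eu n) y := by
          rw [hy, inner_sub_right, inner_smul_right]
          have h3 := (abs_inner_sphere_le (v j) (w₀ : Eu n))
          rw [norm_sphere] at h3
          have h4 : 2 / a * inner ℝ (v j : Eu n) (u₀ : Eu n) ≤ 2 / a * (-a) := by
            gcongr; exact hau j hj
          have h5 : 2 / a * (-a) = -2 := by field_simp
          linarith [(abs_le.1 h3).1]
        rw [h0, hin]
        simp only [Nat.cast_zero, zero_mul, add_zero]
        linarith
      · have := Nat.find_min hex (m := k - 1) (by omega)
        push Not at this
        obtain ⟨i, hi, hgt⟩ := this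
        refine ⟨i, hi, ?_⟩
        rw [hin] at hgt ⊢
        have h1 := (abs_inner_sphere_le (v i) (u₀ : Eu n))
        rw [norm_sphere] at h1
        have h2 : ((k - 1 : ℕ) : ℝ) = k - 1 := by push_cast [Nat.cast_sub h0]; ring
        rw [h2] at hgt
        nlinarith [(abs_le.1 h1).1]
    · have h1 : inner ℝ (w₀ : Eu n) (x + (k * δ) • (u₀ : Eu n)) = inner ℝ (w₀ : Eu n) x := by
        rw [inner_add_right, inner_smul_right, hw₀', mul_zero, add_zero]
      have h2 : inner ℝ (w₀ : Eu n) y = 1 := by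
        rw [hy, inner_sub_right, inner_smul_right, inner_sphere_self, hw₀']; ring
      have h3 := (abs_inner_sphere_le w₀ (x - y)).trans_lt hx
      rw [inner_sub_right, h2] at h3
      have h4 := inner_sphere_le w₀ (x + (k * δ) • (u₀ : Eu n))
      rw [h1] at h4
      linarith [(abs_lt.1 h3).1]
    · have h1 : ‖((k : ℝ) * δ) • (u₀ : Eu n)‖ = k * δ := by
        rw [norm_smul, norm_sphere, mul_one, Real.norm_of_nonneg (by positivity)]
      have h2 : (k : ℝ) * δ ≤ N * δ := by gcongr
      linarith [norm_add_le x (((k : ℝ) * δ) • (u₀ : Eu n))]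
  have hTfin : volume T ≠ ⊤ :=
    ((measure_mono fun x hx => mem_ball_zero_iff.2 hx.2.2).trans_lt
      (measure_ball_lt_top (x := (0 : Eu n)) (r := R))).ne
  have hvol : B ≤ (N + 1) * (volume : Measure (Eu n)).real T := by
    have hpre : ∀ k : ℕ, volume ((fun x : Eu n => x + (k * δ) • (u₀ : Eu n)) ⁻¹' T) = volume T :=
      fun k => measure_preimage_add_right _ _ _
    calc B ≤ (volume : Measure (Eu n)).real (⋃ k ∈ Finset.range (N + 1),
          (fun x : Eu n => x + (k * δ) • (u₀ : Eu n)) ⁻¹' T) := by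
          refine measureReal_mono hcover ((measure_biUnion_finset_le _ _).trans_lt ?_).ne
          exact ENNReal.sum_lt_top.2 fun k _ => (hpre k).symm ▸ hTfin.lt_top
      _ ≤ ∑ k ∈ Finset.range (N + 1), (volume : Measure (Eu n)).real
          ((fun x : Eu n => x + (k * δ) • (u₀ : Eu n)) ⁻¹' T) := measureReal_biUnion_finset_le _ _
      _ = (N + 1) * (volume : Measure (Eu n)).real T := by
          simp only [measureReal_def, hpre]
          simp
  have hNη : ((N : ℝ) + 1) * η ≤ 2 * (2 * F / a + 2) := by
    have : (N : ℝ) * η ≤ 2 * (F / a + 1) := by rw [hδ] at hN2; linarith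
    have h0 : 2 * (2 * F / a + 2) = 4 * (F / a) + 4 := by ring
    have : 0 ≤ F / a := by positivity
    linarith
  rw [div_mul_eq_mul_div, div_le_iff₀ (by positivity)]
  have hσ : 0 ≤ (sphMeasure n).real (layer v I η) := measureReal_nonneg
  calc B * η ≤ (N + 1) * (R ^ n * (sphMeasure n).real (layer v I η)) * η := by
        gcongr; exact hvol.trans (by gcongr)
    _ = (N + 1) * η * (R ^ n * (sphMeasure n).real (layer v I η)) := by ring
    _ ≤ 2 * (2 * F / a + 2) * (R ^ n * (sphMeasure n).real (layer v I η)) := by gcongr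
    _ = _ := by ring

end sphere

end DualOrlicz

namespace DualOrlicz

/-! ### The Orlicz function and the constraint set -/

section phi

variable {ψ : ℝ → ℝ}

/-- The density `ψ(s)/s` of the Orlicz function, extended by `0` to the nonpositive reals. The
extension is continuous when `ψ(s)/s → 0` as `s → 0+`. -/
noncomputable def orliczDensity (ψ : ℝ → ℝ) (s : ℝ) : ℝ := if 0 < s then ψ s / s else 0

/-- The function `orliczPhi ψ`, extended by `0` to the negative reals; this extension is
continuously differentiable on the whole line. -/
noncomputable def orliczPhiExt (ψ : ℝ → ℝ) (t : ℝ) : ℝ := ∫ s in (0 : ℝ)..t, orliczDensity ψ s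

lemma orliczDensity_of_pos {s : ℝ} (hs : 0 < s) : orliczDensity ψ s = ψ s / s := if_pos hs

lemma orliczDensity_zero : orliczDensity ψ 0 = 0 := if_neg (lt_irrefl 0)

lemma orliczDensity_pos (hψ_pos : ∀ t, 0 < t → 0 < ψ t) {s : ℝ} (hs : 0 < s) :
    0 < orliczDensity ψ s := by
  rw [orliczDensity_of_pos hs]
  exact div_pos (hψ_pos s hs) hs

lemma continuous_orliczDensity (hψ_cont : ContinuousOn ψ (Ioi 0))
    (hψ_zero : Tendsto (fun t => ψ t / t) (𝓝[>] 0) (𝓝 0)) : Continuous (orliczDensity ψ) := by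
  rw [continuous_iff_continuousAt]
  intro s
  rcases lt_trichotomy s 0 with hs | rfl | hs
  · refine (continuousAt_const (y := (0 : ℝ))).congr ?_
    filter_upwards [Iio_mem_nhds hs] with t (ht : t < 0)
    exact (if_neg ht.not_gt).symm
  · rw [continuousAt_iff_continuous_left'_right']
    refine ⟨(tendsto_const_nhds (x := (0 : ℝ))).congr' ?_ |>.trans_eq ?_, ?_⟩
    · filter_upwards [self_mem_nhdsWithin] with t (ht : t < 0)
      exact (if_neg ht.not_gt).symm
    · rw [orliczDensity_zero]
    · rw [ContinuousWithinAt, orliczDensity_zero]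
      refine hψ_zero.congr' ?_
      filter_upwards [self_mem_nhdsWithin] with t (ht : 0 < t)
      exact (if_pos ht).symm
  · have : ContinuousAt (fun t => ψ t / t) s :=
      (hψ_cont.continuousAt (Ioi_mem_nhds hs)).div continuousAt_id hs.ne'
    refine this.congr ?_
    filter_upwards [Ioi_mem_nhds hs] with t (ht : 0 < t)
    exact (if_pos ht).symm

lemma orliczPhi_eq_ext {t : ℝ} (ht : 0 ≤ t) : orliczPhi ψ t = orliczPhiExt ψ t := by
  refine intervalIntegral.integral_congr_ae (ae_of_all _ fun s hs => ?_)
  rw [uIoc_of_le ht] at hs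
  exact (orliczDensity_of_pos hs.1).symm

lemma orliczPhiExt_zero : orliczPhiExt ψ 0 = 0 := intervalIntegral.integral_same

lemma hasDerivAt_orliczPhiExt (hc : Continuous (orliczDensity ψ)) (t : ℝ) :
    HasDerivAt (orliczPhiExt ψ) (orliczDensity ψ t) t :=
  intervalIntegral.integral_hasDerivAt_right (hc.intervalIntegrable _ _)
    (hc.stronglyMeasurableAtFilter _ _) hc.continuousAt

lemma strictMonoOn_orliczPhiExt (hψ_pos : ∀ t, 0 < t → 0 < ψ t)
    (hc : Continuous (orliczDensity ψ)) : StrictMonoOn (orliczPhiExt ψ) (Ici 0) := by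
  refine strictMonoOn_of_deriv_pos (convex_Ici 0)
    (fun t _ => (hasDerivAt_orliczPhiExt hc t).continuousAt.continuousWithinAt) fun t ht => ?_
  rw [interior_Ici] at ht
  rw [(hasDerivAt_orliczPhiExt hc t).deriv]
  exact orliczDensity_pos hψ_pos ht

lemma exists_lt_orliczPhiExt (hψ_pos : ∀ t, 0 < t → 0 < ψ t)
    (hc : Continuous (orliczDensity ψ))
    (hψ_top : ∫⁻ s in Ioi (1 : ℝ), ENNReal.ofReal (ψ s / s) = ⊤) (B : ℝ) :
    ∃ T : ℝ, 0 ≤ T ∧ B < orliczPhiExt ψ T := by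
  by_contra! hB
  have hint : IntegrableOn (orliczDensity ψ) (Ioi 1) := by
    refine integrableOn_Ioi_of_intervalIntegral_norm_bounded (l := atTop) (b := id) B 1
      (fun i => (hc.integrableOn_Icc (a := 1) (b := i)).mono_set Ioc_subset_Icc_self)
      tendsto_id ?_
    filter_upwards [eventually_ge_atTop 1] with t ht
    have h1 : ∫ s in (1 : ℝ)..id t, ‖orliczDensity ψ s‖ = ∫ s in (1 : ℝ)..t, orliczDensity ψ s := by
      refine intervalIntegral.integral_congr fun s hs => ?_
      rw [id, uIcc_of_le ht] at hs
      exact Real.norm_of_nonneg (orliczDensity_pos hψ_pos (by linarith [hs.1])).le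
    have h2 : orliczPhiExt ψ t = orliczPhiExt ψ 1 + ∫ s in (1 : ℝ)..t, orliczDensity ψ s :=
      (intervalIntegral.integral_add_adjacent_intervals (hc.intervalIntegrable _ _)
        (hc.intervalIntegrable _ _)).symm
    have h3 : 0 ≤ orliczPhiExt ψ 1 := by
      rw [← orliczPhiExt_zero (ψ := ψ)]
      exact (strictMonoOn_orliczPhiExt hψ_pos hc).monotoneOn (by simp) (by simp) zero_le_one
    rw [h1]
    linarith [hB t (by linarith)]
  have := hint.lintegral_lt_top
  rw [setLIntegral_congr_fun (g := fun s => ENNReal.ofReal (ψ s / s)) measurableSet_Ioi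
    fun s hs => by simp only [orliczDensity_of_pos (zero_lt_one.trans hs)], hψ_top] at this
  exact lt_irrefl _ this

end phi

section constraint

variable {ι : Type*} [Fintype ι] {lam : ι → ℝ} {φ g : ℝ → ℝ} {B : ℝ} {h : ι → ℝ}

/-- The admissible support numbers: `h ≥ 0` and `∑ λᵢ φ(hᵢ) ≤ B`. -/
def orliczBall (lam : ι → ℝ) (φ : ℝ → ℝ) (B : ℝ) : Set (ι → ℝ) :=
  {h | (∀ i, 0 ≤ h i) ∧ ∑ i, lam i * φ (h i) ≤ B}

lemma isCompact_orliczBall (hlam : ∀ i, 0 < lam i) (hφ : Continuous φ) (h0 : φ 0 = 0)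
    (hmono : StrictMonoOn φ (Ici 0)) (htop : ∀ b, ∃ T, 0 ≤ T ∧ b < φ T) :
    IsCompact (orliczBall lam φ B) := by
  have hclosed : IsClosed (orliczBall lam φ B) := by
    refine IsClosed.and ?_ (isClosed_le (by fun_prop) continuous_const)
    rw [ofPred_forall]
    exact isClosed_iInter fun i => isClosed_le continuous_const (continuous_apply i)
  choose T hT0 hT using fun i => htop (B / lam i)
  refine (isCompact_univ_pi fun i => isCompact_Icc (a := 0) (b := T i)).of_isClosed_subset
    hclosed fun h hh i _ => ⟨hh.1 i, ?_⟩
  by_contra! hlt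
  have h1 : φ (T i) < φ (h i) := hmono (hT0 i) (hh.1 i) hlt
  have h2 : B < lam i * φ (h i) := by
    rw [← div_lt_iff₀' (hlam i)]; exact (hT i).trans h1
  have h3 : lam i * φ (h i) ≤ ∑ j, lam j * φ (h j) := by
    refine Finset.single_le_sum (f := fun j => lam j * φ (h j)) (fun j _ => ?_) (Finset.mem_univ i)
    refine mul_nonneg (hlam j).le ?_
    rw [← h0]
    exact hmono.monotoneOn (by simp) (hh.1 j) (hh.1 j)
  linarith [hh.2]

/-- A direction that strictly decreases the constraint to first order, or any direction if the
constraint is not active, is feasible. -/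
lemma eventually_mem_orliczBall (hφ : ∀ t, HasDerivAt φ (g t) t) (hh : h ∈ orliczBall lam φ B)
    {e : ι → ℝ} (he : ∀ i, h i = 0 → 0 ≤ e i)
    (hneg : ∑ i, lam i * (g (h i) * e i) < 0 ∨ ∑ i, lam i * φ (h i) < B) :
    ∀ᶠ s : ℝ in 𝓝[>] 0, h + s • e ∈ orliczBall lam φ B := by
  have hlin : ∀ i, HasDerivAt (fun s : ℝ => h i + s * e i) (e i) 0 := fun i => by
    simpa using ((hasDerivAt_id (0 : ℝ)).mul_const (e i)).const_add (h i)
  have hd : HasDerivAt (fun s : ℝ => ∑ i, lam i * φ (h i + s * e i))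
      (∑ i, lam i * (g (h i) * e i)) 0 := by
    refine HasDerivAt.fun_sum fun i _ => HasDerivAt.const_mul (lam i) ?_
    exact HasDerivAt.comp (h₂ := φ) (0 : ℝ) (by simpa using hφ (h i)) (hlin i)
  have h1 : ∀ᶠ s : ℝ in 𝓝[>] 0, ∀ i, 0 ≤ h i + s * e i := by
    rw [eventually_all]
    intro i
    rcases (hh.1 i).eq_or_lt with h0 | hpos
    · filter_upwards [self_mem_nhdsWithin] with s (hs : 0 < s)
      rw [← h0, zero_add]
      exact mul_nonneg hs.le (he i h0.symm)
    · have h2 := (hlin i).continuousAt.tendsto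
      simp only [zero_mul, add_zero] at h2
      exact ((tendsto_nhdsWithin_of_tendsto_nhds h2).eventually_const_lt hpos).mono
        fun s => le_of_lt
  have h2 : ∀ᶠ s : ℝ in 𝓝[>] 0, ∑ i, lam i * φ (h i + s * e i) ≤ B := by
    rcases hneg with hneg | hlt
    · have h3 := hd.tendsto_slope.mono_left (nhdsGT_le_nhdsNE (0 : ℝ))
      filter_upwards [h3.eventually_lt_const hneg, self_mem_nhdsWithin] with s hs (hs0 : 0 < s)
      rw [slope_def_field, sub_zero, div_lt_iff₀ hs0, zero_mul] at hs
      simp only [zero_mul, add_zero] at hs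
      linarith [hh.2]
    · have h3 := hd.continuousAt.tendsto
      simp only [zero_mul, add_zero] at h3
      exact ((tendsto_nhdsWithin_of_tendsto_nhds h3).eventually_lt_const hlt).mono
        fun s => le_of_lt
  filter_upwards [h1, h2] with s hs1 hs2
  exact ⟨by simpa using hs1, by simpa using hs2⟩

end constraint

end DualOrlicz

namespace DualOrlicz

/-! ### The dual volume of a Wulff shape -/

variable {n : ℕ} {ι : Type*} {G : ℝ → Sph n → ℝ} {v : ι → Sph n} {h : ι → ℝ}

/-- The regularity assumed of `G`: it is continuous on `[0, ∞) × S^{n-1}`, and its `t`-derivative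
exists, is continuous, and is positive on `(0, ∞) × S^{n-1}`. -/
structure IsRadialDensity (G : ℝ → Sph n → ℝ) : Prop where
  continuousOn : ContinuousOn (fun p : ℝ × Sph n => G p.1 p.2) (Ici 0 ×ˢ univ)
  differentiableAt : ∀ t, 0 < t → ∀ w, DifferentiableAt ℝ (fun s => G s w) t
  continuousOn_partialT :
    ContinuousOn (fun p : ℝ × Sph n => partialT G p.1 p.2) (Ioi 0 ×ˢ univ)
  partialT_pos : ∀ t, 0 < t → ∀ w, 0 < partialT G t w

namespace IsRadialDensity

variable (hG : IsRadialDensity G)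
include hG

lemma continuous_max : Continuous fun p : ℝ × Sph n => G (max p.1 0) p.2 :=
  hG.continuousOn.comp_continuous (f := fun p : ℝ × Sph n => (max p.1 0, p.2)) (by fun_prop)
    fun p => ⟨mem_Ici.2 (le_max_right _ _), mem_univ _⟩

lemma hasDerivAt {t : ℝ} (ht : 0 < t) (w : Sph n) :
    HasDerivAt (fun s => G s w) (partialT G t w) t := (hG.differentiableAt t ht w).hasDerivAt

lemma continuousOn_left (w : Sph n) : ContinuousOn (fun s => G s w) (Ici 0) :=
  hG.continuousOn.comp (f := fun s : ℝ => (s, w)) (by fun_prop) fun _ hs => ⟨hs, mem_univ _⟩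

lemma strictMonoOn (w : Sph n) : StrictMonoOn (fun s => G s w) (Ici 0) := by
  refine strictMonoOn_of_deriv_pos (convex_Ici 0) (hG.continuousOn_left w) fun t ht => ?_
  rw [interior_Ici] at ht
  exact hG.partialT_pos t ht w

/-- The gain `G(a, w) - G(0, w)` is bounded below uniformly in the direction `w`. -/
lemma exists_gap {a : ℝ} (ha : 0 < a) : ∃ g : ℝ, 0 < g ∧ ∀ w, g ≤ G a w - G 0 w := by
  rcases isEmpty_or_nonempty (Sph n) with he | he
  · exact ⟨1, one_pos, fun w => he.elim w⟩
  have hc : Continuous fun w : Sph n => G a w - G 0 w := by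
    refine Continuous.sub ?_ ?_
    · exact hG.continuousOn.comp_continuous (f := fun w : Sph n => (a, w)) (by fun_prop)
        fun p => ⟨ha.le, mem_univ _⟩
    · exact hG.continuousOn.comp_continuous (f := fun w : Sph n => ((0 : ℝ), w)) (by fun_prop)
        fun p => ⟨self_mem_Ici, mem_univ _⟩
  obtain ⟨w, -, hw⟩ := isCompact_univ.exists_isMinOn univ_nonempty hc.continuousOn
  exact ⟨_, sub_pos.2 (hG.strictMonoOn w (by simp) ha.le ha), fun w' => hw (mem_univ w')⟩

lemma exists_bound (b : ℝ) : ∃ M : ℝ, ∀ w, ∀ t ∈ Icc 0 b, |G t w| ≤ M := by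
  obtain ⟨M, hM⟩ := ((isCompact_Icc (a := 0) (b := b)).prod
    (isCompact_univ (X := Sph n))).exists_bound_of_continuousOn
    (hG.continuousOn.mono (prod_mono Icc_subset_Ici_self subset_rfl))
  exact ⟨M, fun w t ht => hM (t, w) ⟨ht, mem_univ _⟩⟩

lemma exists_lipschitz {a b : ℝ} (ha : 0 < a) :
    ∃ L : ℝ, 0 < L ∧ ∀ w, ∀ x ∈ Icc a b, ∀ y ∈ Icc a b, |G x w - G y w| ≤ L * |x - y| := by
  obtain ⟨M, hM⟩ := ((isCompact_Icc (a := a) (b := b)).prod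
    (isCompact_univ (X := Sph n))).exists_bound_of_continuousOn
    (hG.continuousOn_partialT.mono
      (prod_mono (fun t ht => ha.trans_le ht.1) subset_rfl))
  refine ⟨max M 1, by positivity, fun w x hx y hy => ?_⟩
  exact (convex_Icc a b).norm_image_sub_le_of_norm_hasDerivWithin_le
    (fun t ht => (hG.hasDerivAt (ha.trans_le ht.1) w).hasDerivWithinAt)
    (fun t ht => (hM (t, w) ⟨ht, mem_univ _⟩).trans (le_max_left _ _)) hy hx

lemma measurable_comp {r : Sph n → ℝ} (hr : Measurable r) (hr0 : ∀ w, 0 ≤ r w) :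
    Measurable fun w => G (r w) w := by
  have := hG.continuous_max.measurable.comp (hr.prodMk measurable_id)
  simpa only [Function.comp_def, id, max_eq_left (hr0 _)] using this

lemma integrable_comp {r : Sph n → ℝ} (hr : Measurable r) (hr0 : ∀ w, 0 ≤ r w) {b : ℝ}
    (hrb : ∀ w, r w ≤ b) : Integrable (fun w => G (r w) w) (sphMeasure n) := by
  obtain ⟨M, hM⟩ := hG.exists_bound b
  exact Integrable.of_bound (hG.measurable_comp hr hr0).aestronglyMeasurable M
    (ae_of_all _ fun w => hM w _ ⟨hr0 w, hrb w⟩)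

end IsRadialDensity

/-- The general dual volume `∫ G(ρ(w), w) dw` of the Wulff shape `wulff v h`, with radial function
`ρ`. -/
noncomputable def dualVolume (G : ℝ → Sph n → ℝ) (v : ι → Sph n) (h : ι → ℝ) : ℝ :=
  ∫ w, G (radius v h w) w ∂(sphMeasure n)

section dualVolume

variable [Fintype ι] (hG : IsRadialDensity G) (hv : MeetsOpenHemispheres v)
include hv

/-- If the dual volume is not minimal, the cone of directions cut off by no halfspace through the
origin is full-dimensional. -/
lemma exists_inner_neg_of_lt_dualVolume (hh : ∀ i, 0 ≤ h i)
    (hlt : ∫ w, G 0 w ∂(sphMeasure n) < dualVolume G v h) :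
    ∃ u₀ : Sph n, ∀ i, h i = 0 → inner ℝ (v i : Eu n) (u₀ : Eu n) < 0 := by
  by_contra! hno
  refine hlt.ne (integral_congr_ae ?_)
  -- the directions orthogonal to some `v i` are negligible
  have hnull : ∀ᵐ w : Sph n ∂(sphMeasure n), ∀ i, inner ℝ (v i : Eu n) (w : Eu n) ≠ 0 := by
    rw [ae_all_iff]
    intro i
    rw [ae_iff]
    simpa using sphMeasure_inner_eq_zero (y := (v i : Eu n)) (by
      intro h; simpa [h] using norm_sphere (v i))
  filter_upwards [hnull] with w hw
  obtain ⟨i, hi, hiw⟩ := hno w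
  rw [radius_eq_zero hv hh hi (lt_of_le_of_ne hiw (hw i).symm)]

include hG

lemma integrable_dualVolume (hh : ∀ i, 0 ≤ h i) :
    Integrable (fun w => G (radius v h w) w) (sphMeasure n) := by
  obtain ⟨C, hC, H⟩ := exists_radius_le hv
  exact hG.integrable_comp (measurable_radius hv h) (fun w => radius_nonneg hv hh)
    (H h ‖h‖ (norm_nonneg _) fun i => (Real.le_norm_self _).trans (norm_le_pi_norm h i))

lemma continuousOn_dualVolume {K : Set (ι → ℝ)} (hK : IsCompact K) (hK0 : ∀ h ∈ K, ∀ i, 0 ≤ h i) :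
    ContinuousOn (dualVolume G v) K := by
  obtain ⟨C, hC, H⟩ := exists_radius_le hv
  obtain ⟨R, hR⟩ := hK.isBounded.exists_norm_le
  obtain ⟨M, hM⟩ := hG.exists_bound (C * R)
  refine continuousOn_of_dominated (bound := fun _ => M)
    (fun h hh => (integrable_dualVolume hG hv (hK0 h hh)).aestronglyMeasurable)
    (fun h hh => ae_of_all _ fun w => hM w _ ⟨radius_nonneg hv (hK0 h hh), ?_⟩)
    (integrable_const _) (ae_of_all _ fun w => ?_)
  · exact H h R ((norm_nonneg _).trans (hR h hh))
      (fun i => (Real.le_norm_self _).trans ((norm_le_pi_norm h i).trans (hR h hh))) w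
  · exact (hG.continuousOn_left w).comp (continuous_radius_left hv w).continuousOn
      fun h hh => radius_nonneg hv (hK0 h hh)

/-- The dual volume exceeds that of the degenerate Wulff shape `{0}` as soon as all support
numbers are positive. -/
lemma dualVolume_zero_lt (hn : 2 ≤ n) (hh : ∀ i, 0 < h i) :
    ∫ w, G 0 w ∂(sphMeasure n) < dualVolume G v h := by
  have : NeZero n := ⟨by omega⟩
  have hσ : sphMeasure n ≠ 0 := by
    have : Nontrivial (Eu n) := inferInstance
    exact (volume : Measure (Eu n)).toSphere_ne_zero
  have h0 : Integrable (fun w => G 0 w) (sphMeasure n) :=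
    hG.integrable_comp (r := fun _ => 0) measurable_const (fun _ => le_rfl) (b := 0)
      fun _ => le_rfl
  have hlt : ∀ w, G 0 w < G (radius v h w) w := fun w =>
    hG.strictMonoOn w (by simp) (radius_pos hv hh).le (radius_pos hv hh)
  have h1 := integrable_dualVolume hG hv (fun i => (hh i).le)
  rw [← sub_pos, dualVolume, ← integral_sub h1 h0,
    integral_pos_iff_support_of_nonneg (fun w => (sub_pos.2 (hlt w)).le) (h1.sub h0)]
  rw [show Function.support (fun w => G (radius v h w) w - G 0 w) = univ from
    eq_univ_of_forall fun w => (sub_pos.2 (hlt w)).ne']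
  exact pos_iff_ne_zero.2 (Measure.measure_univ_ne_zero.2 hσ)

/-- A maximizer of the dual volume has positive support numbers.

If `I = {i | hᵢ = 0}` were nonempty, then enlarging these `hᵢ` to `ε` and shrinking the other ones
to `(1 - κ ε) hᵢ` would be feasible for small `ε`, because `φ'(0) = 0`. It gains a fixed positive
amount on the layer of measure `≥ c ε` around the cone `⟪vᵢ, ·⟫ ≤ 0`, `i ∈ I`, and loses at most
`O(κ ε)`, so that it increases the dual volume once `κ` is small. -/
lemma pos_of_isMaxOn_dualVolume (hn : 2 ≤ n) {lam : ι → ℝ} {φ g : ℝ → ℝ} {B : ℝ}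
    (hlam : ∀ i, 0 < lam i) (hφ : ∀ t, HasDerivAt φ (g t) t) (hg0 : g 0 = 0)
    (hg : ∀ t, 0 < t → 0 < g t) (hh : h ∈ orliczBall lam φ B)
    (hmax : IsMaxOn (dualVolume G v) (orliczBall lam φ B) h)
    (hlt : ∫ w, G 0 w ∂(sphMeasure n) < dualVolume G v h) : ∀ i, 0 < h i := by
  classical
  set I : Set ι := {i | h i = 0} with hI
  have hJ : ∀ i, i ∉ I → 0 < h i := fun i hi => lt_of_le_of_ne (hh.1 i) (Ne.symm hi)
  by_contra! hex
  obtain ⟨i₀, hi₀⟩ := hex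
  have hi₀ : i₀ ∈ I := le_antisymm hi₀ (hh.1 i₀)
  obtain ⟨u₀, hu₀⟩ := exists_inner_neg_of_lt_dualVolume hv hh.1 hlt
  obtain ⟨c, hc, hlayer⟩ := exists_le_sphMeasure_layer hn ⟨i₀, hi₀⟩ hu₀
  obtain ⟨j₀, hj₀u⟩ := hv u₀
  have hj₀ : j₀ ∉ I := fun h => (hu₀ j₀ h).not_gt hj₀u
  -- a lower bound for the nonzero support numbers
  obtain ⟨a, ha, haJ⟩ : ∃ a : ℝ, 0 < a ∧ ∀ i, i ∉ I → a ≤ h i := by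
    obtain ⟨j, hj, hmin⟩ := Set.exists_min_image Iᶜ h Iᶜ.toFinite ⟨j₀, hj₀⟩
    exact ⟨h j, hJ j hj, hmin⟩
  obtain ⟨C, hC, hCr⟩ := exists_radius_le hv
  set b : ℝ := C * ‖h‖ with hb
  have hrb : ∀ w, radius v h w ≤ b := hCr h ‖h‖ (norm_nonneg _)
    fun i => (Real.le_norm_self _).trans (norm_le_pi_norm h i)
  have hb0 : 0 ≤ b := by positivity
  obtain ⟨L, hL, hLip⟩ := hG.exists_lipschitz (a := a / 2) (b := b) (by positivity)
  obtain ⟨γ, hγ, hgap⟩ := hG.exists_gap (a := a / 2) (by positivity)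
  set S : ℝ := (sphMeasure n).real univ with hS
  have hS0 : 0 ≤ S := measureReal_nonneg
  -- chosen so that the loss `κ L b S` is smaller than the gain `γ c (2 / a)`
  obtain ⟨κ, hκ, hκ1⟩ : ∃ κ : ℝ, 0 < κ ∧ κ * (L * b * S) < γ * (c * (2 / a)) := by
    refine ⟨γ * (c * (2 / a)) / (L * b * S + 1), by positivity, ?_⟩
    rw [div_mul_eq_mul_div, div_lt_iff₀ (by positivity)]
    have : 0 < γ * (c * (2 / a)) := by positivity
    nlinarith
  set e : ι → ℝ := fun i => if i ∈ I then 1 else -κ * h i with he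
  have hneg : ∑ i, lam i * (g (h i) * e i) < 0 := by
    refine Finset.sum_neg' (fun i _ => ?_) ⟨j₀, Finset.mem_univ _, ?_⟩
    · by_cases hi : i ∈ I
      · rw [show h i = 0 from hi, hg0]; simp
      · have := mul_pos (mul_pos (hlam i) (hg _ (hJ i hi))) (mul_pos hκ (hJ i hi))
        simp only [he, if_neg hi]
        linarith
    · have := mul_pos (mul_pos (hlam j₀) (hg _ (hJ j₀ hj₀))) (mul_pos hκ (hJ j₀ hj₀))
      simp only [he, if_neg hj₀]
      linarith
  have hfeas := eventually_mem_orliczBall hφ hh (e := e)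
    (fun i hi => by simp [he, show i ∈ I from hi]) (Or.inl hneg)
  have hsmall : ∀ r : ℝ, 0 < r → ∀ᶠ ε : ℝ in 𝓝[>] 0, ε < r := fun r hr =>
    (eventually_lt_nhds hr).filter_mono nhdsWithin_le_nhds
  obtain ⟨ε, ⟨hε, hε0⟩, hεκ, hεa⟩ := ((hfeas.and self_mem_nhdsWithin).and
    ((hsmall (1 / (2 * κ)) (by positivity)).and (hsmall (a / 2) (by positivity)))).exists
  replace hε0 : 0 < ε := hε0
  have hκε : κ * ε ≤ 1 / 2 := by
    have := (lt_div_iff₀ (by positivity)).1 hεκ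
    linarith
  set h' : ι → ℝ := h + ε • e with hh'
  have hI' : ∀ i ∈ I, h' i = ε := fun i hi => by
    simp [hh', he, hi, show h i = 0 from hi]
  have hJ' : ∀ i, i ∉ I → h' i = (1 - κ * ε) * h i := fun i hi => by
    simp [hh', he, hi]; ring
  set A : Set (Sph n) := layer v I (2 / a * ε) with hA
  have hAσ : c * (2 / a * ε) ≤ (sphMeasure n).real A := by
    refine hlayer _ (by positivity) ?_
    rw [div_mul_eq_mul_div, div_le_one ha]
    linarith
  have hpt : ∀ w, G (radius v h w) w + (A.indicator (fun _ => γ) w - L * (κ * ε * b)) ≤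
      G (radius v h' w) w := by
    intro w
    have hloss : 0 ≤ L * (κ * ε * b) := by positivity
    have hr' := radius_nonneg (w := w) hv hε.1
    by_cases hw : w ∈ A
    -- on the layer the radius jumps from `0` to at least `a / 2`
    · obtain ⟨⟨i, hi, hiw⟩, hAw⟩ := id hw
      rw [radius_eq_zero hv hh.1 hi hiw, indicator_of_mem hw]
      have h1 : a / 2 ≤ radius v h' w := by
        refine (le_radius_iff hv).2 fun j hj => ?_
        by_cases hjI : j ∈ I
        · rw [hI' j hjI]
          calc a / 2 * inner ℝ (v j : Eu n) (w : Eu n) ≤ a / 2 * (2 / a * ε) := by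
                gcongr; exact hAw j hjI
            _ = ε := by field_simp
        · rw [hJ' j hjI]
          have h2 : inner ℝ (v j : Eu n) (w : Eu n) ≤ 1 := by
            simpa using inner_sphere_le (v j) (w : Eu n)
          nlinarith [haJ j hjI]
      have h2 := (hG.strictMonoOn w).monotoneOn (show (0 : ℝ) ≤ a / 2 by positivity) hr' h1
      linarith [hgap w]
    · rw [indicator_of_notMem hw]
      -- off the layer the radius stays nonnegative, or shrinks by a factor of at most `1 - κ ε`
      rcases (radius_nonneg (w := w) hv hh.1).eq_or_lt with h0 | hpos
      · rw [← h0]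
        have h2 := (hG.strictMonoOn w).monotoneOn (show (0 : ℝ) ≤ 0 from le_rfl) hr' hr'
        linarith
      · have hIw : ∀ i ∈ I, inner ℝ (v i : Eu n) (w : Eu n) ≤ 0 := fun i hi => by
          by_contra! hiw
          exact hpos.ne' (radius_eq_zero hv hh.1 hi hiw)
        have har : a ≤ radius v h w := by
          refine (le_radius_iff hv).2 fun j hj => ?_
          have hjI : j ∉ I := fun hjI => (hIw j hjI).not_gt hj
          have h2 : inner ℝ (v j : Eu n) (w : Eu n) ≤ 1 := by
            simpa using inner_sphere_le (v j) (w : Eu n)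
          nlinarith [haJ j hjI]
        have hsr : (1 - κ * ε) * radius v h w ≤ radius v h' w := by
          refine (le_radius_iff hv).2 fun j hj => ?_
          have hjI : j ∉ I := fun hjI => (hIw j hjI).not_gt hj
          rw [hJ' j hjI, mul_assoc]
          have : 0 ≤ 1 - κ * ε := by linarith
          gcongr
          exact radius_mul_le hj
        have hs0 : a / 2 ≤ (1 - κ * ε) * radius v h w := by nlinarith
        have hκr : 0 ≤ κ * ε * radius v h w := by positivity
        have h2 := (hG.strictMonoOn w).monotoneOn
          (show (0 : ℝ) ≤ (1 - κ * ε) * radius v h w by linarith) hr' hsr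
        have h3 := hLip w (radius v h w) ⟨by linarith, hrb w⟩ ((1 - κ * ε) * radius v h w)
          ⟨hs0, by linarith [hrb w]⟩
        rw [show radius v h w - (1 - κ * ε) * radius v h w = κ * ε * radius v h w by ring,
          abs_of_nonneg hκr] at h3
        have h4 : L * (κ * ε * radius v h w) ≤ L * (κ * ε * b) := by gcongr; exact hrb w
        linarith [le_abs_self (G (radius v h w) w - G ((1 - κ * ε) * radius v h w) w)]
  have hAint : Integrable (A.indicator fun _ => γ) (sphMeasure n) :=
    (integrable_const γ).indicator (measurableSet_layer v I _)
  have h1 := integrable_dualVolume hG hv hh.1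
  have h7 : Integrable (fun w => A.indicator (fun _ => γ) w - L * (κ * ε * b)) (sphMeasure n) :=
    hAint.sub (integrable_const _)
  have hint := integral_mono (h1.add h7) (integrable_dualVolume hG hv hε.1) hpt
  have h2 : ∫ w, (G (radius v h w) w + (A.indicator (fun _ => γ) w - L * (κ * ε * b)))
      ∂(sphMeasure n) = dualVolume G v h + ((sphMeasure n).real A * γ - S * (L * (κ * ε * b))) := by
    rw [integral_add h1 h7, integral_sub hAint (integrable_const _),
      integral_indicator_const _ (measurableSet_layer v I _), integral_const]
    rfl
  have h3 : dualVolume G v h + ((sphMeasure n).real A * γ - S * (L * (κ * ε * b))) ≤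
      dualVolume G v h' := h2 ▸ hint
  have h4 : dualVolume G v h' ≤ dualVolume G v h := hmax hε
  have h5 := mul_lt_mul_of_pos_right hκ1 hε0
  have h6 := mul_le_mul_of_nonneg_right hAσ hγ.le
  linarith

end dualVolume

end DualOrlicz

namespace DualOrlicz

/-! ### Facets, and the derivative of the dual volume -/

variable {n : ℕ} {ι : Type*} {G : ℝ → Sph n → ℝ} {v : ι → Sph n} {h : ι → ℝ}

/-- The directions in which the boundary of `wulff v h` lies on the `i`-th facet hyperplane. -/
def facetDirections (v : ι → Sph n) (h : ι → ℝ) (i : ι) : Set (Sph n) :=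
  {w | radius v h w * inner ℝ (v i : Eu n) (w : Eu n) = h i}

/-- The integral of `ρ G_t(ρ, ·)` over the directions of the `i`-th facet. -/
noncomputable def facetIntegral (G : ℝ → Sph n → ℝ) (v : ι → Sph n) (h : ι → ℝ) (i : ι) : ℝ :=
  ∫ w in facetDirections v h i, radius v h w * partialT G (radius v h w) w ∂(sphMeasure n)

section facets

variable [Finite ι] (hv : MeetsOpenHemispheres v) (hh : ∀ i, 0 < h i)
include hv hh

lemma measurableSet_facetDirections (i : ι) : MeasurableSet (facetDirections v h i) :=
  (isClosed_eq ((continuous_radius_right hv hh).mul (by fun_prop)) continuous_const).measurableSet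

/-- Almost every direction belongs to exactly one facet: directions of two facets satisfy a
nontrivial linear equation. -/
lemma ae_exists_forall_mem_facetDirections_iff (hinj : Function.Injective v) :
    ∀ᵐ w ∂(sphMeasure n), ∃ k, ∀ i, w ∈ facetDirections v h i ↔ i = k := by
  have hnull : ∀ᵐ w : Sph n ∂(sphMeasure n), ∀ i j, i ≠ j →
      inner ℝ (h j • (v i : Eu n) - h i • (v j : Eu n)) (w : Eu n) ≠ 0 := by
    simp only [ae_all_iff]
    intro i j hij
    rw [ae_iff]
    simp only [ne_eq, not_not]
    refine sphMeasure_inner_eq_zero fun h0 => hij (hinj ?_)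
    have h1 := sub_eq_zero.1 h0
    have h2 : h j = h i := by
      have := congrArg norm h1
      simpa [norm_smul, abs_of_pos (hh _)] using this
    rw [h2] at h1
    exact Subtype.ext (smul_right_injective _ (hh i).ne' h1)
  filter_upwards [hnull] with w hw
  obtain ⟨k, -, hk⟩ := radius_attained hv h w
  refine ⟨k, fun i => ⟨fun hi => ?_, fun e => e ▸ hk⟩⟩
  by_contra hik
  have hi : radius v h w * inner ℝ (v i : Eu n) (w : Eu n) = h i := hi
  refine hw i k hik ?_
  rw [inner_sub_left, real_inner_smul_left, real_inner_smul_left, ← hi, ← hk]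
  ring

/-- Integration facet by facet. -/
lemma setIntegral_eq_sum_facetDirections (hinj : Function.Injective v) {S : Set (Sph n)}
    {T : Finset ι} {F : Sph n → ℝ} {f : ι → Sph n → ℝ}
    (hf : ∀ i, Integrable (f i) (sphMeasure n))
    (hS : ∀ w k, (∀ i, w ∈ facetDirections v h i ↔ i = k) → (w ∈ S ↔ k ∈ T) ∧ F w = f k w) :
    ∫ w in S, F w ∂(sphMeasure n) =
      ∑ i ∈ T, ∫ w in facetDirections v h i, f i w ∂(sphMeasure n) := by
  classical
  have hm := measurableSet_facetDirections hv hh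
  have hae := ae_exists_forall_mem_facetDirections_iff hv hh hinj
  have hSU : S =ᵐ[sphMeasure n] (⋃ i ∈ T, facetDirections v h i : Set (Sph n)) := by
    rw [eventuallyEq_set]
    filter_upwards [hae] with w ⟨k, hk⟩
    rw [(hS w k hk).1]
    simp [hk]
  rw [setIntegral_congr_set hSU, ← integral_indicator (Finset.measurableSet_biUnion _
    fun i _ => hm i)]
  have hsum : ∀ i ∈ T, ∫ w in facetDirections v h i, f i w ∂(sphMeasure n) =
      ∫ w, (facetDirections v h i).indicator (f i) w ∂(sphMeasure n) :=
    fun i _ => (integral_indicator (hm i)).symm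
  rw [Finset.sum_congr rfl hsum, ← integral_finsetSum _ fun i _ => (hf i).indicator (hm i)]
  refine integral_congr_ae ?_
  filter_upwards [hae] with w ⟨k, hk⟩
  simp only [indicator_apply, mem_iUnion, hk, exists_prop, exists_eq_right, Finset.sum_ite_eq',
    (hS w k hk).2]

lemma continuous_radius_mul_partialT (hG : IsRadialDensity G) :
    Continuous fun w => radius v h w * partialT G (radius v h w) w := by
  have hr := continuous_radius_right hv hh
  exact hr.mul (hG.continuousOn_partialT.comp_continuous (hr.prodMk continuous_id)
    fun w => ⟨radius_pos hv hh, mem_univ _⟩)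

lemma integrable_radius_mul_partialT (hG : IsRadialDensity G) :
    Integrable (fun w => radius v h w * partialT G (radius v h w) w) (sphMeasure n) :=
  (continuous_radius_mul_partialT hv hh hG).integrable_of_hasCompactSupport
    (HasCompactSupport.of_compactSpace _)

end facets

variable [Fintype ι] (hG : IsRadialDensity G) (hv : MeetsOpenHemispheres v) (hh : ∀ i, 0 < h i)

include hv in
/-- The radial function varies by a factor of at most `1 ± ‖x - h‖ / a` when the support numbers
`h ≥ a` are changed to `x`. -/
lemma abs_radius_sub_le {a : ℝ} (ha : 0 < a) (hah : ∀ i, a ≤ h i) {x : ι → ℝ}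
    (hx : ‖x - h‖ ≤ a) (w : Sph n) : |radius v x w - radius v h w| ≤ ‖x - h‖ / a * radius v h w := by
  set δ := ‖x - h‖ / a with hδ
  have hδ1 : δ ≤ 1 := (div_le_one ha).2 hx
  have hx : ∀ i, |x i - h i| ≤ δ * h i := fun i => by
    calc |x i - h i| ≤ ‖x - h‖ := norm_le_pi_norm (x - h) i
      _ = δ * a := by rw [hδ]; field_simp
      _ ≤ δ * h i := by gcongr; exact hah i
  rw [abs_le]
  constructor
  · have : (1 - δ) * radius v h w ≤ radius v x w := by
      refine (le_radius_iff hv).2 fun i hi => ?_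
      have h1 := (abs_le.1 (hx i)).1
      have h2 := radius_mul_le (h := h) hi
      nlinarith
    linarith
  · obtain ⟨j, hj, e⟩ := radius_attained hv h w
    refine le_of_mul_le_mul_right ?_ hj
    have h1 := (abs_le.1 (hx j)).2
    have h2 := radius_mul_le (h := x) hj
    rw [sub_mul, mul_assoc, e]
    linarith

section derivative

omit [Fintype ι] in
lemma integrable_sum_smul_const {α E : Type*} [MeasurableSpace α] {μ : Measure α}
    [NormedAddCommGroup E] [NormedSpace ℝ E] (s : Finset ι) {f : ι → α → ℝ}
    (hf : ∀ i, Integrable (f i) μ) (c : ι → E) :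
    Integrable (fun w => ∑ i ∈ s, f i w • c i) μ :=
  integrable_finsetSum _ fun i _ => (hf i).smul_const (c i)

omit [Fintype ι] in
lemma integral_sum_smul_const {α E : Type*} [MeasurableSpace α] {μ : Measure α}
    [NormedAddCommGroup E] [NormedSpace ℝ E] [CompleteSpace E] (s : Finset ι) {f : ι → α → ℝ}
    (hf : ∀ i, Integrable (f i) μ) (c : ι → E) :
    ∫ w, ∑ i ∈ s, f i w • c i ∂μ = ∑ i ∈ s, (∫ w, f i w ∂μ) • c i := by
  rw [integral_finsetSum _ fun i _ => (hf i).smul_const (c i)]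
  exact Finset.sum_congr rfl fun i _ => integral_smul_const _ _

include hG hv hh

/-- In a direction `w` that belongs to the `k`-th facet only, the radial function depends on `h`
locally through `h k` only. -/
lemma hasFDerivAt_comp_radius {w : Sph n} {k : ι}
    (hk : ∀ i, w ∈ facetDirections v h i ↔ i = k) :
    HasFDerivAt (fun x : ι → ℝ => G (radius v x w) w)
      ((radius v h w * partialT G (radius v h w) w / h k) •
        (ContinuousLinearMap.proj k : (ι → ℝ) →L[ℝ] ℝ)) h := by
  have hr := continuous_radius_left hv w
  have hrk : radius v h w * inner ℝ (v k : Eu n) (w : Eu n) = h k := (hk k).2 rfl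
  have hev : ∀ᶠ x in 𝓝 h, ∀ i, i ≠ k → radius v x w * inner ℝ (v i : Eu n) (w : Eu n) ≠ x i := by
    rw [eventually_all]
    intro i
    by_cases hik : i = k
    · simp [hik]
    · have h1 : radius v h w * inner ℝ (v i : Eu n) (w : Eu n) ≠ h i :=
        fun h2 => hik ((hk i).1 h2)
      filter_upwards [(isOpen_ne_fun (hr.mul continuous_const) (continuous_apply i)).mem_nhds h1]
        with x hx _ using hx
  have heq : (fun x : ι → ℝ => radius v x w) =ᶠ[𝓝 h]
      fun x => (inner ℝ (v k : Eu n) (w : Eu n))⁻¹ * x k := by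
    filter_upwards [hev] with x hx
    obtain ⟨i, hi, e⟩ := radius_attained hv x w
    obtain rfl : i = k := by by_contra hik; exact hx i hik e
    rw [← e]
    field_simp
  have hd : HasFDerivAt (fun x : ι → ℝ => radius v x w)
      ((inner ℝ (v k : Eu n) (w : Eu n))⁻¹ • (ContinuousLinearMap.proj k : (ι → ℝ) →L[ℝ] ℝ)) h :=
    (((ContinuousLinearMap.proj k : (ι → ℝ) →L[ℝ] ℝ).hasFDerivAt).const_mul _).congr_of_eventuallyEq
      heq
  refine ((hG.hasDerivAt (radius_pos hv hh) w).comp_hasFDerivAt h hd).congr_fderiv ?_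
  rw [smul_smul]
  congr 1
  have h1 : radius v h w ≠ 0 := (radius_pos hv hh).ne'
  have h2 : inner ℝ (v k : Eu n) (w : Eu n) ≠ 0 := fun h0 => (hh k).ne' (by rw [← hrk, h0, mul_zero])
  rw [← hrk]
  field_simp

/-- Hadamard-type variational formula: the partial derivative of the dual volume in the `i`-th support
number is the `i`-th facet integral divided by that support number. -/
lemma hasFDerivAt_dualVolume (hinj : Function.Injective v) :
    HasFDerivAt (dualVolume G v) (∑ i, (facetIntegral G v h i / h i) •
      (ContinuousLinearMap.proj i : (ι → ℝ) →L[ℝ] ℝ)) h := by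
  classical
  obtain ⟨a, ha, hah⟩ : ∃ a : ℝ, 0 < a ∧ ∀ i, a ≤ h i := by
    rcases isEmpty_or_nonempty ι with he | he
    · exact ⟨1, one_pos, fun i => he.elim i⟩
    · obtain ⟨j, hj⟩ := Finite.exists_min h
      exact ⟨h j, hh j, hj⟩
  obtain ⟨C, hC, hCr⟩ := exists_radius_le hv
  set b : ℝ := C * ‖h‖ with hb
  have hrb : ∀ w, radius v h w ≤ b := hCr h ‖h‖ (norm_nonneg _)
    fun i => (Real.le_norm_self _).trans (norm_le_pi_norm h i)
  have har : ∀ w, a ≤ radius v h w := fun w => (le_radius_iff hv).2 fun j hj => by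
    have h2 : inner ℝ (v j : Eu n) (w : Eu n) ≤ 1 := by
      simpa using inner_sphere_le (v j) (w : Eu n)
    nlinarith [hah j]
  obtain ⟨L, hL, hLip⟩ := hG.exists_lipschitz (a := a / 2) (b := 2 * b) (by positivity)
  set F' : Sph n → (ι → ℝ) →L[ℝ] ℝ := fun w => ∑ i, (facetDirections v h i).indicator
    (fun w => radius v h w * partialT G (radius v h w) w / h i) w •
      (ContinuousLinearMap.proj i : (ι → ℝ) →L[ℝ] ℝ) with hF'
  have hm := measurableSet_facetDirections hv hh
  have hint : ∀ i, Integrable ((facetDirections v h i).indicator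
      (fun w => radius v h w * partialT G (radius v h w) w / h i)) (sphMeasure n) := fun i =>
    ((integrable_radius_mul_partialT hv hh hG).div_const _).indicator (hm i)
  have hF'i : Integrable F' (sphMeasure n) :=
    integrable_sum_smul_const Finset.univ hint _
  have hF'int : ∫ w, F' w ∂(sphMeasure n) = ∑ i, (facetIntegral G v h i / h i) •
      (ContinuousLinearMap.proj i : (ι → ℝ) →L[ℝ] ℝ) := by
    rw [hF', integral_sum_smul_const Finset.univ hint]
    refine Finset.sum_congr rfl fun i _ => ?_
    rw [integral_indicator (hm i), integral_div, facetIntegral]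
  have hx0 : ∀ x ∈ Metric.ball h (a / 2), ‖x - h‖ ≤ a ∧ ‖x - h‖ / a ≤ 1 / 2 ∧
      ∀ i, 0 ≤ x i := by
    intro x hx
    rw [mem_ball_iff_norm] at hx
    refine ⟨by linarith, by rw [div_le_iff₀ ha]; linarith, fun i => ?_⟩
    have := norm_le_pi_norm (x - h) i
    rw [Pi.sub_apply, Real.norm_eq_abs] at this
    linarith [(abs_le.1 this).1, hah i]
  have hlip : ∀ᵐ w ∂(sphMeasure n), ∀ x ∈ Metric.ball h (a / 2),
      ‖G (radius v x w) w - G (radius v h w) w‖ ≤ L * (b / a) * ‖x - h‖ := by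
    refine ae_of_all _ fun w x hx => ?_
    obtain ⟨hxa, hδ, -⟩ := hx0 x hx
    have h1 := abs_radius_sub_le hv ha hah hxa w
    have h2 : ‖x - h‖ / a * radius v h w ≤ 1 / 2 * radius v h w := by
      gcongr; exact (radius_pos hv hh).le
    have h3 := abs_le.1 (h1.trans h2)
    rw [Real.norm_eq_abs]
    calc |G (radius v x w) w - G (radius v h w) w| ≤ L * |radius v x w - radius v h w| := by
          refine hLip w _ ⟨?_, ?_⟩ _ ⟨?_, ?_⟩ <;> linarith [har w, hrb w]
      _ ≤ L * (‖x - h‖ / a * b) := by gcongr; exact h1.trans (by gcongr; exact hrb w)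
      _ = L * (b / a) * ‖x - h‖ := by ring
  have hdiff : ∀ᵐ w ∂(sphMeasure n), HasFDerivAt (fun x => G (radius v x w) w) (F' w) h := by
    filter_upwards [ae_exists_forall_mem_facetDirections_iff hv hh hinj] with w ⟨k, hk⟩
    refine (hasFDerivAt_comp_radius hG hv hh hk).congr_fderiv ?_
    simp [hF', indicator_apply, hk]
  have hmeas : ∀ x ∈ Metric.ball h (a / 2), AEStronglyMeasurable
      (fun w => G (radius v x w) w) (sphMeasure n) := fun x hx =>
    (integrable_dualVolume hG hv (hx0 x hx).2.2).aestronglyMeasurable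
  have hint0 := integrable_dualVolume hG hv fun i => (hh i).le
  have hF'm := hF'i.aestronglyMeasurable
  rw [← hF'int]
  clear hF'int hF'i hF'
  clear_value F'
  have key := hasFDerivAt_integral_of_dominated_loc_of_lip' (𝕜 := ℝ)
    (F := fun (x : ι → ℝ) w => G (radius v x w) w) (bound := fun _ => L * (b / a))
    (Metric.ball_mem_nhds h (half_pos ha)) hmeas hint0 hF'm hlip (integrable_const _) hdiff
  exact key.2

end derivative

/-! ### The Lagrange condition at a maximizer -/

/-- The sum of the facet integrals is the integral of `ρ G_t(ρ, ·)` over the sphere, a positive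
number. -/
lemma sum_facetIntegral_pos (hn : 2 ≤ n) (hinj : Function.Injective v) (hG : IsRadialDensity G)
    (hv : MeetsOpenHemispheres v) (hh : ∀ i, 0 < h i) : 0 < ∑ i, facetIntegral G v h i := by
  have : NeZero n := ⟨by omega⟩
  have h1 := setIntegral_eq_sum_facetDirections hv hh hinj (S := univ) (T := Finset.univ)
    (F := fun w => radius v h w * partialT G (radius v h w) w)
    (fun _ => integrable_radius_mul_partialT hv hh hG) (fun w k _ => by simp)
  rw [setIntegral_univ] at h1
  have hpos : ∀ w, 0 < radius v h w * partialT G (radius v h w) w := fun w =>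
    mul_pos (radius_pos hv hh) (hG.partialT_pos _ (radius_pos hv hh) _)
  simp only [facetIntegral]
  rw [← h1]
  obtain ⟨w⟩ : Nonempty (Sph n) := (NormedSpace.sphere_nonempty.2 zero_le_one).to_subtype
  exact (continuous_radius_mul_partialT hv hh hG).integral_pos_of_hasCompactSupport_nonneg_nonzero
    (HasCompactSupport.of_compactSpace _) (fun w => (hpos w).le) (hpos w).ne'

/-- At a maximizer with positive support numbers the facet integrals satisfy the Lagrange
condition, and the constraint is active. -/
lemma exists_multiplier_of_isMaxOn (hn : 2 ≤ n) (hinj : Function.Injective v)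
    (hG : IsRadialDensity G) (hv : MeetsOpenHemispheres v) (hh : ∀ i, 0 < h i)
    {lam : ι → ℝ} {φ g : ℝ → ℝ} {B : ℝ}
    (hlam : ∀ i, 0 < lam i) (hφ : ∀ t, HasDerivAt φ (g t) t) (hg : ∀ t, 0 < t → 0 < g t)
    (hhB : h ∈ orliczBall lam φ B) (hmax : IsMaxOn (dualVolume G v) (orliczBall lam φ B) h) :
    ∑ i, lam i * φ (h i) = B ∧
      ∃ κ : ℝ, 0 < κ ∧ ∀ i, facetIntegral G v h i = κ * (lam i * (g (h i) * h i)) := by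
  classical
  have hfirst : ∀ e : ι → ℝ,
      (∑ i, lam i * (g (h i) * e i) < 0 ∨ ∑ i, lam i * φ (h i) < B) →
      ∑ i, facetIntegral G v h i / h i * e i ≤ 0 := by
    intro e he
    have hfeas := eventually_mem_orliczBall hφ hhB (e := e) (fun i hi => ((hh i).ne' hi).elim) he
    have hd : HasDerivAt (fun s : ℝ => dualVolume G v (h + s • e))
        (∑ i, facetIntegral G v h i / h i * e i) 0 := by
      have := (hasFDerivAt_dualVolume hG hv hh hinj).hasLineDerivAt e
      simpa [HasLineDerivAt, sum_apply] using this
    have h1 := hd.tendsto_slope.mono_left (nhdsGT_le_nhdsNE (0 : ℝ))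
    refine le_of_tendsto h1 ?_
    filter_upwards [hfeas, self_mem_nhdsWithin] with s hs (hs0 : 0 < s)
    rw [slope_def_field, zero_smul, add_zero, sub_zero]
    exact div_nonpos_of_nonpos_of_nonneg (sub_nonpos.2 (hmax hs)) hs0.le
  have hsum := sum_facetIntegral_pos hn hinj hG hv hh
  set A : ι → ℝ := fun i => lam i * g (h i) with hA
  have hA0 : ∀ i, 0 < A i := fun i => mul_pos (hlam i) (hg _ (hh i))
  set b : ι → ℝ := fun i => facetIntegral G v h i / h i with hb
  -- compare the `i`-th and `j`-th partial derivatives, in a direction that trades `i` for `j`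
  have hle : ∀ i j, A j * b i ≤ A i * b j := by
    intro i j
    by_contra! hlt
    have hij : i ≠ j := by rintro rfl; exact lt_irrefl _ hlt
    -- the slack `δ` makes the constraint decrease strictly
    obtain ⟨δ, hδ, hδ1⟩ : ∃ δ : ℝ, 0 < δ ∧ δ * b i < A j * b i - A i * b j := by
      refine ⟨(A j * b i - A i * b j) / (|b i| + 1), div_pos (by linarith) (by positivity), ?_⟩
      rw [div_mul_eq_mul_div, div_lt_iff₀ (by positivity)]
      nlinarith [le_abs_self (b i), abs_nonneg (b i)]
    have key : ∀ c : ι → ℝ, ∑ k, c k * (Pi.single i (A j - δ) - Pi.single j (A i) : ι → ℝ) k =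
        c i * (A j - δ) - c j * A i := by
      intro c
      simp [mul_sub, Finset.sum_sub_distrib, Pi.single_apply]
    have h1 := hfirst (Pi.single i (A j - δ) - Pi.single j (A i)) (Or.inl (by
      simp only [← mul_assoc]
      rw [key fun k => lam k * g (h k)]
      have := mul_pos (hA0 i) hδ
      simp only [hA] at this ⊢
      linarith))
    rw [key fun k => facetIntegral G v h k / h k] at h1
    simp only [hb] at h1 hδ1
    linarith
  obtain ⟨j, -, hj⟩ := Finset.exists_lt_of_sum_lt (s := Finset.univ)
    (f := fun _ : ι => (0 : ℝ)) (g := facetIntegral G v h) (by simpa using hsum)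
  refine ⟨le_antisymm hhB.2 (not_lt.1 fun hlt => ?_), b j / A j, div_pos (div_pos hj (hh j)) (hA0 j),
    fun i => ?_⟩
  · have := hfirst h (Or.inr hlt)
    rw [Finset.sum_congr rfl fun i _ => div_mul_cancel₀ _ (hh i).ne'] at this
    linarith
  · have h1 : A j * b i = A i * b j := le_antisymm (hle i j) (hle j i)
    have h2 : facetIntegral G v h i = b i * h i := (div_mul_cancel₀ _ (hh i).ne').symm
    have h3 : b i = A i * b j / A j := by
      rw [eq_div_iff (hA0 j).ne']; linarith
    rw [h2, h3]
    simp only [hA]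
    ring

end DualOrlicz

namespace DualOrlicz

/-! ### The curvature measure of a Wulff shape -/

section curvature

variable {n : ℕ} {ι : Type*} [Fintype ι] {G : ℝ → Sph n → ℝ} {v : ι → Sph n} {h : ι → ℝ}
  (hv : MeetsOpenHemispheres v) (hh : ∀ i, 0 < h i)

include hv hh

lemma radialMap_wulff (w : Sph n) :
    radialMap (wulff v h) w = radius v h w • (w : Eu n) := by
  rw [radialMap, radialFn_wulff hv fun i => (hh i).le]

lemma radialMap_mem_wulff (w : Sph n) : radialMap (wulff v h) w ∈ wulff v h := fun i => by
  rw [radialMap_wulff hv hh, inner_smul_right]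
  exact radius_mul_le' hv (fun i => (hh i).le) i

lemma inner_radialMap_wulff_eq_iff {w : Sph n} {i : ι} :
    inner ℝ (v i : Eu n) (radialMap (wulff v h) w) = h i ↔ w ∈ facetDirections v h i := by
  rw [radialMap_wulff hv hh, inner_smul_right]
  rfl

lemma supportFn_wulff {w : Sph n} {i : ι} (hw : w ∈ facetDirections v h i) :
    supportFn (wulff v h) (v i) = h i := by
  refine IsGreatest.csSup_eq ⟨⟨_, radialMap_mem_wulff hv hh w,
    (inner_radialMap_wulff_eq_iff hv hh).2 hw⟩, ?_⟩
  rintro _ ⟨x, hx, rfl⟩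
  exact hx i

lemma radialMap_wulff_mem_frontier (w : Sph n) :
    radialMap (wulff v h) w ∈ frontier (wulff v h) := by
  refine ⟨subset_closure (radialMap_mem_wulff hv hh w), fun hint => ?_⟩
  obtain ⟨k, -, hk⟩ := radius_attained hv h w
  have hk' := (inner_radialMap_wulff_eq_iff hv hh).2 (show w ∈ facetDirections v h k from hk)
  have ht : Tendsto (fun t : ℝ => radialMap (wulff v h) w + t • (v k : Eu n)) (𝓝[>] 0)
      (𝓝 (radialMap (wulff v h) w + (0 : ℝ) • (v k : Eu n))) :=
    tendsto_nhdsWithin_of_tendsto_nhds (Continuous.tendsto (by fun_prop) 0)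
  rw [zero_smul, add_zero] at ht
  obtain ⟨t, h1, h2 : 0 < t⟩ :=
    ((ht.eventually_mem (mem_interior_iff_mem_nhds.1 hint)).and self_mem_nhdsWithin).exists
  have h3 := h1 k
  rw [inner_add_right, hk', inner_smul_right, inner_sphere_self] at h3
  linarith

variable {w : Sph n} {k : ι} (hk : ∀ i, w ∈ facetDirections v h i ↔ i = k)
include hk

lemma mem_normalCone_radialMap_wulff_iff (e : Sph n) :
    (e : Eu n) ∈ normalCone (wulff v h) (radialMap (wulff v h) w) ↔ e = v k :=
  mem_normalCone_wulff_iff (radialMap_mem_wulff hv hh w)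
    (fun i => (inner_radialMap_wulff_eq_iff hv hh).trans (hk i)) e

lemma radialGauss_wulff : radialGauss (wulff v h) w = v k := by
  have hmem : ∀ e, e ∈ radialSphericalImage (wulff v h) {w} ↔ e = v k := fun e => by
    rw [← mem_normalCone_radialMap_wulff_iff hv hh hk e]
    simp [radialSphericalImage, sphericalImage]
  have hex : ∃! e, e ∈ radialSphericalImage (wulff v h) {w} :=
    ⟨v k, (hmem _).2 rfl, fun e he => (hmem e).1 he⟩
  rw [radialGauss, dif_pos hex]
  exact (hmem _).1 hex.choose_spec.1

lemma mem_reverseRadialSphericalImage_wulff_iff (E : Set (Sph n)) :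
    w ∈ reverseRadialSphericalImage (wulff v h) E ↔ v k ∈ E := by
  simp only [reverseRadialSphericalImage, reverseSphericalImage, mem_preimage, mem_ofPred_eq,
    radialMap_wulff_mem_frontier hv hh, mem_normalCone_radialMap_wulff_iff hv hh hk, true_and,
    exists_eq_right]

omit hk in
open Classical in
/-- The curvature measure of a Wulff shape is concentrated on the facet normals. -/
lemma dualOrliczCurvature_wulff (hinj : Function.Injective v) (hG : IsRadialDensity G)
    (ψ : ℝ → ℝ) (E : Set (Sph n)) :
    dualOrliczCurvature G ψ (wulff v h) E = 1 / n * ∑ i with v i ∈ E,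
      facetIntegral G v h i / ψ (supportFn (wulff v h) (v i)) := by
  rw [dualOrliczCurvature, setIntegral_eq_sum_facetDirections hv hh hinj
    (T := Finset.univ.filter fun i => v i ∈ E)
    (f := fun i w => radius v h w * partialT G (radius v h w) w /
      ψ (supportFn (wulff v h) (v i)))
    (fun i => (integrable_radius_mul_partialT hv hh hG).div_const _)]
  · simp only [integral_div, facetIntegral]
  · intro w k hk
    refine ⟨?_, ?_⟩
    · rw [mem_reverseRadialSphericalImage_wulff_iff hv hh hk]
      simp
    · rw [radialGauss_wulff hv hh hk, radialFn_wulff hv fun i => (hh i).le]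

end curvature

/-! ### Discrete measures -/

section discrete

variable {n : ℕ} {ι : Type*} [Fintype ι] {lam : ι → ℝ} {v : ι → Sph n} {μ : Measure (Sph n)}

lemma integral_discrete (hlam : ∀ i, 0 ≤ lam i)
    (hμ : μ = ∑ i, ENNReal.ofReal (lam i) • Measure.dirac (v i)) (f : Sph n → ℝ) :
    ∫ w, f w ∂μ = ∑ i, lam i * f (v i) := by
  rw [hμ, integral_finsetSum_measure fun i _ =>
    (integrable_dirac (by simp)).smul_measure ENNReal.ofReal_ne_top]
  refine Finset.sum_congr rfl fun i _ => ?_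
  rw [integral_smul_measure, integral_dirac, ENNReal.toReal_ofReal (hlam i), smul_eq_mul]

open Classical in
lemma measureReal_discrete (hlam : ∀ i, 0 ≤ lam i)
    (hμ : μ = ∑ i, ENNReal.ofReal (lam i) • Measure.dirac (v i)) {E : Set (Sph n)}
    (hE : MeasurableSet E) : μ.real E = ∑ i with v i ∈ E, lam i := by
  rw [← integral_indicator_one hE, integral_discrete hlam hμ, Finset.sum_filter]
  simp [indicator_apply]

/-- A finitely supported measure can be written with distinct atoms, by merging the weights of
repeated ones. -/
lemma exists_injective_discrete {m : ℕ} {lam : Fin m → ℝ} (hlam : ∀ i, 0 < lam i)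
    (u : Fin m → Sph n) :
    ∃ (lam' : range u → ℝ), (∀ w, 0 < lam' w) ∧
      discreteMeasure lam u = ∑ w, ENNReal.ofReal (lam' w) • Measure.dirac (w : Sph n) := by
  classical
  refine ⟨fun w => ∑ i with u i = w, lam i, fun w => ?_, ?_⟩
  · obtain ⟨i, hi⟩ := w.2
    exact Finset.sum_pos (fun i _ => hlam i) ⟨i, by simpa using hi⟩
  · rw [discreteMeasure, ← Finset.sum_fiberwise Finset.univ (rangeFactorization u)]
    refine Finset.sum_congr rfl fun w _ => ?_
    rw [ENNReal.ofReal_sum_of_nonneg fun i _ => (hlam i).le, Finset.sum_smul]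
    refine Finset.sum_congr (Finset.filter_congr fun i _ => ?_) fun i hi => ?_
    · exact Subtype.ext_iff
    · rw [(Finset.mem_filter.1 hi).2]

end discrete

/-! ### The Orlicz–Minkowski problem for discrete measures -/

/-- The discrete Minkowski problem for a measure with distinct atoms. -/
theorem exists_wulff_of_discrete {n : ℕ} {ι : Type*} [Fintype ι] (hn : 2 ≤ n)
    {lam : ι → ℝ} (hlam : ∀ i, 0 < lam i) {v : ι → Sph n} (hinj : Function.Injective v)
    (hv : MeetsOpenHemispheres v) {G : ℝ → Sph n → ℝ} (hG : IsRadialDensity G) {ψ : ℝ → ℝ}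
    (hψ_pos : ∀ t, 0 < t → 0 < ψ t) (hψ_cont : ContinuousOn ψ (Ioi 0))
    (hψ_zero : Tendsto (fun t => ψ t / t) (𝓝[>] 0) (𝓝 0))
    (hψ_top : ∫⁻ s in Ioi (1 : ℝ), ENNReal.ofReal (ψ s / s) = ⊤)
    {μ : Measure (Sph n)} (hμ : μ = ∑ i, ENNReal.ofReal (lam i) • Measure.dirac (v i)) :
    ∃ (P : Set (Eu n)) (τ : ℝ),
      IsConvexPolytope P ∧ IsBodyAroundOrigin P ∧ 0 < τ ∧
      (∀ E : Set (Sph n), MeasurableSet E → μ.real E = τ * dualOrliczCurvature G ψ P E) ∧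
      orliczNorm (orliczPhi ψ) μ (supportFn P) = 1 ∧
      τ = μ.real univ / dualOrliczCurvature G ψ P univ ∧
      τ = 1 / dualOrliczCurvature G (fun _ => 1) P univ * ∫ w, ψ (supportFn P w) ∂μ := by
  classical
  have hc := continuous_orliczDensity hψ_cont hψ_zero
  have hφ := hasDerivAt_orliczPhiExt hc
  have hφc : Continuous (orliczPhiExt ψ) :=
    continuous_iff_continuousAt.2 fun t => (hφ t).continuousAt
  have hmono := strictMonoOn_orliczPhiExt hψ_pos hc
  have hμreal : ∀ {E : Set (Sph n)}, MeasurableSet E → μ.real E = ∑ i with v i ∈ E, lam i :=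
    fun hE => measureReal_discrete (fun i => (hlam i).le) hμ hE
  have hμuniv : μ.real univ = ∑ i, lam i := by simp [hμreal MeasurableSet.univ]
  obtain ⟨w₀⟩ : Nonempty (Sph n) := by
    have : NeZero n := ⟨by omega⟩
    exact (NormedSpace.sphere_nonempty.2 zero_le_one).to_subtype
  have : Nonempty ι := let ⟨i, _⟩ := hv w₀; ⟨i⟩
  have hμpos : 0 < ∑ i, lam i := Finset.sum_pos (fun i _ => hlam i) Finset.univ_nonempty
  have hφ1 : 0 < orliczPhiExt ψ 1 := by
    rw [← orliczPhiExt_zero (ψ := ψ)]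
    exact hmono self_mem_Ici (mem_Ici.2 zero_le_one) one_pos
  -- maximize the dual volume under `∑ λᵢ φ(hᵢ) ≤ φ(1) μ(S)`, which is satisfied by `h = 1`
  set B : ℝ := orliczPhiExt ψ 1 * ∑ i, lam i with hB
  have hcomp : IsCompact (orliczBall lam (orliczPhiExt ψ) B) :=
    isCompact_orliczBall hlam hφc orliczPhiExt_zero hmono
      (exists_lt_orliczPhiExt hψ_pos hc hψ_top)
  have hone : (fun _ => 1 : ι → ℝ) ∈ orliczBall lam (orliczPhiExt ψ) B :=
    ⟨fun _ => zero_le_one, by rw [hB, ← Finset.sum_mul, mul_comm]⟩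
  obtain ⟨h, hhB, hmax⟩ := hcomp.exists_isMaxOn ⟨_, hone⟩
    (continuousOn_dualVolume hG hv hcomp fun h hh => hh.1)
  have hh := pos_of_isMaxOn_dualVolume hG hv hn hlam hφ orliczDensity_zero
    (fun t => orliczDensity_pos hψ_pos) hhB hmax
    ((dualVolume_zero_lt hG hv hn fun _ => one_pos).trans_le (hmax hone))
  obtain ⟨hactive, κ, hκ, hfacet⟩ := exists_multiplier_of_isMaxOn hn hinj hG hv hh hlam hφ
    (fun t => orliczDensity_pos hψ_pos) hhB hmax
  replace hfacet : ∀ i, facetIntegral G v h i = κ * (lam i * ψ (h i)) := fun i => by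
    rw [hfacet i, orliczDensity_of_pos (hh i), div_mul_cancel₀ _ (hh i).ne']
  have hsupp : ∀ i, supportFn (wulff v h) (v i) = h i := fun i => by
    have hne : (facetDirections v h i).Nonempty := by
      by_contra hempty
      have h1 : facetIntegral G v h i = 0 := by
        rw [facetIntegral, not_nonempty_iff_eq_empty.1 hempty, setIntegral_empty]
      rw [hfacet i] at h1
      exact (mul_pos hκ (mul_pos (hlam i) (hψ_pos _ (hh i)))).ne' h1
    exact supportFn_wulff hv hh hne.some_mem
  have hn0 : (0 : ℝ) < n := by exact_mod_cast (by omega : 0 < n)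
  have hcurv : ∀ E : Set (Sph n), MeasurableSet E →
      dualOrliczCurvature G ψ (wulff v h) E = κ / n * μ.real E := fun E hE => by
    rw [dualOrliczCurvature_wulff hv hh hinj hG, hμreal hE, div_mul_eq_mul_div, one_mul,
      div_mul_eq_mul_div, Finset.mul_sum]
    congr 1
    refine Finset.sum_congr rfl fun i _ => ?_
    have := (hψ_pos _ (hh i)).ne'
    rw [hsupp, hfacet]
    field_simp
  have hcurv1 : dualOrliczCurvature G (fun _ => 1) (wulff v h) univ =
      κ / n * ∑ i, lam i * ψ (h i) := by
    rw [dualOrliczCurvature_wulff hv hh hinj hG, div_mul_eq_mul_div, one_mul,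
      div_mul_eq_mul_div, Finset.mul_sum]
    simp [hfacet]
  refine ⟨wulff v h, n / κ, isConvexPolytope_wulff hv h, isBodyAroundOrigin_wulff hv hh,
    by positivity, fun E hE => ?_, ?_, ?_, ?_⟩
  · rw [hcurv E hE]
    field_simp
  · have hset : {l : ℝ | 0 < l ∧ 1 / (orliczPhi ψ 1 * μ.real univ) *
        ∫ w, orliczPhi ψ (supportFn (wulff v h) w / l) ∂μ ≤ 1} = Ici 1 := by
      ext l
      simp only [mem_ofPred_eq, mem_Ici]
      have key : 0 < l → (1 / (orliczPhi ψ 1 * μ.real univ) *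
          ∫ w, orliczPhi ψ (supportFn (wulff v h) w / l) ∂μ ≤ 1 ↔
          ∑ i, lam i * orliczPhiExt ψ (h i / l) ≤ ∑ i, lam i * orliczPhiExt ψ (h i)) := by
        intro hl
        rw [integral_discrete (fun i => (hlam i).le) hμ, orliczPhi_eq_ext zero_le_one, hμuniv,
          ← hB, hactive, one_div, inv_mul_le_iff₀ (by positivity), mul_one]
        simp only [hsupp, orliczPhi_eq_ext (div_nonneg (hh _).le hl.le)]
      constructor
      · rintro ⟨hl, hle⟩
        by_contra! hl1
        refine ((key hl).1 hle).not_gt (Finset.sum_lt_sum_of_nonempty Finset.univ_nonempty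
          fun i _ => mul_lt_mul_of_pos_left (hmono (hh i).le (div_nonneg (hh i).le hl.le) ?_)
            (hlam i))
        rw [lt_div_iff₀ hl]
        exact mul_lt_of_lt_one_right (hh i) hl1
      · intro hl1
        have hl : 0 < l := zero_lt_one.trans_le hl1
        refine ⟨hl, (key hl).2 (Finset.sum_le_sum fun i _ => mul_le_mul_of_nonneg_left
          (hmono.monotoneOn (div_nonneg (hh i).le hl.le) (hh i).le ?_) (hlam i).le)⟩
        exact div_le_self (hh i).le hl1
    rw [orliczNorm, hset, csInf_Ici]
  · rw [hcurv _ MeasurableSet.univ, hμuniv]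
    field_simp
  · have hpos : 0 < ∑ i, lam i * ψ (h i) :=
      Finset.sum_pos (fun i _ => mul_pos (hlam i) (hψ_pos _ (hh i))) Finset.univ_nonempty
    rw [hcurv1, integral_discrete (fun i => (hlam i).le) hμ]
    simp only [hsupp]
    field_simp

end DualOrlicz

theorem mainTheorem1 {n m : ℕ} (hn : 2 ≤ n)
    (lam : Fin m → ℝ) (hlam : ∀ i, 0 < lam i)
    (u : Fin m → Sph n) (hu : ∀ v : Sph n, ¬ (range u ⊆ closedHemisphere v))
    (G : ℝ → Sph n → ℝ)
    (hG_nonneg : ∀ t, 0 ≤ t → ∀ w, 0 ≤ G t w)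
    (hG_cont : ContinuousOn (fun p : ℝ × Sph n => G p.1 p.2) (Ici 0 ×ˢ univ))
    (hG_diff : ∀ t, 0 < t → ∀ w, DifferentiableAt ℝ (fun s => G s w) t)
    (hGt_cont : ContinuousOn (fun p : ℝ × Sph n => partialT G p.1 p.2) (Ioi 0 ×ˢ univ))
    (hGt_pos : ∀ t, 0 < t → ∀ w, 0 < partialT G t w)
    (ψ : ℝ → ℝ)
    (hψ_pos : ∀ t, 0 < t → 0 < ψ t)
    (hψ_cont : ContinuousOn ψ (Ioi 0))
    (hψ_zero : Tendsto (fun t => ψ t / t) (𝓝[>] 0) (𝓝 0))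
    (hψ_top : ∫⁻ s in Ioi (1 : ℝ), ENNReal.ofReal (ψ s / s) = ⊤)
    (μ : Measure (Sph n)) (hμ : μ = discreteMeasure lam u) :
    ∃ (P : Set (Eu n)) (τ : ℝ),
      IsConvexPolytope P ∧ IsBodyAroundOrigin P ∧ 0 < τ ∧
      (∀ E : Set (Sph n), MeasurableSet E → μ.real E = τ * dualOrliczCurvature G ψ P E) ∧
      orliczNorm (orliczPhi ψ) μ (supportFn P) = 1 ∧
      τ = μ.real univ / dualOrliczCurvature G ψ P univ ∧
      τ = 1 / dualOrliczCurvature G (fun _ => 1) P univ * ∫ w, ψ (supportFn P w) ∂μ := by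
  classical
  have hv : MeetsOpenHemispheres (fun w : range u => (w : Sph n)) := by
    intro w
    obtain ⟨_, ⟨i, rfl⟩, hi⟩ := not_subset.1 (hu (-w))
    refine ⟨⟨u i, i, rfl⟩, ?_⟩
    have h1 : ¬ 0 ≤ inner ℝ (u i : Eu n) ((-w : Sph n) : Eu n) := hi
    simpa [inner_neg_right] using h1
  obtain ⟨lam', hlam', hμ'⟩ := exists_injective_discrete hlam u
  exact exists_wulff_of_discrete hn hlam' Subtype.val_injective hv
    ⟨hG_cont, hG_diff, hGt_cont, hGt_pos⟩ hψ_pos hψ_cont hψ_zero hψ_top (hμ.trans hμ')
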